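/- **Setting.** Let $M$ be a connected Riemann surface and let $X=(x_1,x_2,x_3):M\to\mathbb{R}^3$ be a conformal minimal immersion (not assumed complete or embedded). Let $N:M\to S^2$ be its Gauss map, $g=\sigma\circ N:M\to\mathbb{C}\cup\{\infty\}$ with $\sigma$ the stereographic projection from the north pole, and $dh=dx_3-i\,dx_3\circ\mathrm{Rot}_{\pi/2}$, where $\mathrm{Rot}_{\pi/2}$ is the rotation of the tangent planes by $\pi/2$ in the positive direction. For $\lambda>0$ the López–Ros deformation of $X$ is the (possibly multi-valued) map $$X_\lambda=\operatorname{Re}\int\Phi_\lambda,\qquad \Phi_\lambda=\Big(\tfrac12(\lambda^{-1}g^{-1}-\lambda g),\ \tfrac i2(\lambda^{-1}g^{-1}+\lambda g),\ 1\Big)dh,$$ which has the Weierstrass data $\{\lambda g, dh\}$. Here $g\,dh$ and $g^{-1}dh$ are extended to the poles, respectively the zeros, of $g$ by the holomorphic forms $-(\phi_1+i\phi_2)$ and $\phi_1-i\phi_2$, with $\phi_k=dx_k-i\,dx_k\circ\mathrm{Rot}_{\pi/2}$; this also covers horizontal planes, for which $dh\equiv0$. $X_\lambda$ is *single-valued*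 if there is a map $X_\lambda:M\to\mathbb{R}^3$ whose increment along every $C^1$ curve $\gamma:[0,1]\to M$ is $\operatorname{Re}\int_\gamma\Phi_\lambda$. The map $X$ (respectively $X_\lambda$) is *complete* if every divergent curve in $M$, that is, every $C^1$ curve $[0,\infty)\to M$ that eventually leaves each compact set, has infinite length with respect to $ds=|dX|$ (respectively $ds_\lambda=|\operatorname{Re}\Phi_\lambda|$). An immersion has *finite total curvature* if $\int_M|K|\,dA<\infty$ for its Gauss curvature $K$ and its area element $dA$. Finally, $X$ has *vertical flux* if, for every closed curve $\gamma$ in $M$, the vector $\int \mathrm{Rot}_{\pi/2}\big(\tfrac{d(X\circ\gamma)}{ds}\big)\,ds$ is a multiple of $(0,0,1)$. **Proposition 3.2.** 1. For every $\lambda>0$, $X$ is complete if and only if $X_\lambda$ is complete. (In particular, $X$ is complete if and only if every $X_\lambda$, $\lambda>0$, is complete.) 2. For every $\lambda>0$ for which $X_\lambda$ is single-valued, the total curvature of $X$ is finite if and only if the total curvature of $X_\lambda$ is finite. 3. $X_\lambda$ is single-valued for all $\lambda>0$ if and only if $X$ has vertical flux. -/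

import Mathlib

open scoped Manifold ContDiff

noncomputable section

namespace LopezRos

open MeasureTheory Set Filter Complex

/-- Euclidean three-space. -/
abbrev E3 : Type := EuclideanSpace ℝ (Fin 3)

/-- The vector product of `E3`. -/
def cross (v w : E3) : E3 :=
  WithLp.toLp 2 (crossProduct (WithLp.ofLp v) (WithLp.ofLp w))

variable {M : Type*} [TopologicalSpace M] [ChartedSpace ℂ M]

/-! ### First and second order geometry of a map from a Riemann surface to space

The real tangent space of `M` at `p` is, in Mathlib, the model space `ℂ` (through the preferred
chart at `p`).  As changes of charts are holomorphic, multiplication by `I` on it is the complex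
structure of `M`, that is, rotation by a right angle, and `(1, I)` is a positively oriented
basis `(∂/∂u, ∂/∂v)`. -/

/-- The differential of `X` at `p`. -/
def d (X : M → E3) (p : M) : ℂ →L[ℝ] E3 :=
  mfderiv 𝓘(ℝ, ℂ) 𝓘(ℝ, E3) X p

/-- The Gauss map: the unit normal `(∂X/∂u × ∂X/∂v) / |∂X/∂u × ∂X/∂v|`. -/
def gaussMap (X : M → E3) (p : M) : E3 :=
  ‖cross (d X p 1) (d X p I)‖⁻¹ • cross (d X p 1) (d X p I)

/-- The basis `(∂/∂u, ∂/∂v)` of the tangent space. -/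
def basisVec : Fin 2 → ℂ := ![1, I]

/-- The matrix of the first fundamental form at `p`. -/
def firstForm (X : M → E3) (p : M) : Matrix (Fin 2) (Fin 2) ℝ :=
  Matrix.of fun i j => inner ℝ (d X p (basisVec i)) (d X p (basisVec j))

/-- The matrix of the second fundamental form `⟨S U, V⟩ = ⟨DN U, DX V⟩` at `p`. -/
def secondForm (X : M → E3) (p : M) : Matrix (Fin 2) (Fin 2) ℝ :=
  Matrix.of fun i j => inner ℝ (d (gaussMap X) p (basisVec i)) (d X p (basisVec j))

/-- The mean curvature: half the trace of the shape operator. -/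
def meanCurvature (X : M → E3) (p : M) : ℝ :=
  ((firstForm X p)⁻¹ * secondForm X p).trace / 2

/-- The Gauss curvature: the determinant of the shape operator. -/
def gaussCurvature (X : M → E3) (p : M) : ℝ :=
  (secondForm X p).det / (firstForm X p).det

/-- `X : M → ℝ³` is a conformal minimal immersion (of class `C²`, which is what the mean
curvature needs).  That the differential is a conformal linear map (a nonzero multiple of an
isometric embedding) at every point contains that `X` is an immersion. -/
structure IsConformalMinimalImmersion (X : M → E3) : Prop where
  contMDiff : ContMDiff 𝓘(ℝ, ℂ) 𝓘(ℝ, E3) 2 X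
  conformal : ∀ p, IsConformalMap (d X p)
  minimal : ∀ p, meanCurvature X p = 0

/-! ### Area and total curvature -/

/-- The area measure induced on `M` by an immersion `Y`: the least measure that dominates, for
every chart `e` of the atlas, the measure `|∂Y/∂u × ∂Y/∂v| du dv` on the domain of `e`.  These
measures agree on overlaps (change of variables), so that the least upper bound restricts to each
of them. -/
def area [MeasurableSpace M] (Y : M → E3) : Measure M :=
  ⨆ e ∈ atlas ℂ M,
    Measure.map e.symm
      ((volume.withDensity fun z : ℂ =>
        ‖cross (fderiv ℝ (Y ∘ e.symm) z 1) (fderiv ℝ (Y ∘ e.symm) z I)‖ₑ).restrict e.target)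

/-- The immersion `Y` has finite total curvature: `∫ |K| dA < ∞`. -/
def HasFiniteTotalCurvature [MeasurableSpace M] (Y : M → E3) : Prop :=
  ∫⁻ p, ‖gaussCurvature Y p‖ₑ ∂(area Y) < ⊤

/-! ### Curves, completeness, flux -/

/-- The velocity vector of a curve in `M`. -/
def velocity (γ : ℝ → M) (t : ℝ) : ℂ :=
  mfderiv 𝓘(ℝ, ℝ) 𝓘(ℝ, ℂ) γ t (1 : ℝ)

/-- `γ` restricts to a `C¹` curve on `[0, 1]`. -/
def IsCurve (γ : ℝ → M) : Prop :=
  ContMDiffOn 𝓘(ℝ, ℝ) 𝓘(ℝ, ℂ) 1 γ (Icc 0 1)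

/-- `γ` restricts to a divergent `C¹` curve on `[0, ∞)`: it leaves every compact set. -/
def IsDivergentCurve (γ : ℝ → M) : Prop :=
  ContMDiffOn 𝓘(ℝ, ℝ) 𝓘(ℝ, ℂ) 1 γ (Ici 0) ∧ Tendsto γ atTop (cocompact M)

/-- Completeness of the metric `ds = |α|` that is induced by an `ℝ³`-valued one-form `α`: every
divergent curve has infinite length.  For a map into `ℝ³`, `α` is its differential; the
differential of a multi-valued map, all of whose branches differ by constants, is a well-defined
one-form on `M` too. -/
def IsCompleteForm (α : M → ℂ → E3) : Prop :=
  ∀ γ : ℝ → M, IsDivergentCurve γ → ∫⁻ t in Ioi (0 : ℝ), ‖α (γ t) (velocity γ t)‖ₑ = ⊤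

/-- The map `X` is complete. -/
def IsCompleteMap (X : M → E3) : Prop :=
  IsCompleteForm fun p v => d X p v

/-- The flux `∫ Rot (dγ/ds) ds` of `X` along the curve `X ∘ γ`, where `Rot` is the rotation by a
right angle about the normal `N`, `Rot w = N × w`. -/
def flux (X : M → E3) (γ : ℝ → M) : E3 :=
  ∫ t in (0 : ℝ)..1, cross (gaussMap X (γ t)) (d X (γ t) (velocity γ t))

/-- The flux along every closed curve is a vertical vector. -/
def HasVerticalFlux (X : M → E3) : Prop :=
  ∀ γ : ℝ → M, IsCurve γ → γ 0 = γ 1 → flux X γ 0 = 0 ∧ flux X γ 1 = 0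

/-! ### Weierstrass data and the López–Ros deformation -/

/-- Stereographic projection of the unit sphere from the north pole. -/
def stereo (n : E3) : OnePoint ℂ :=
  open Classical in
  if n 2 = 1 then OnePoint.infty else (((n 0 + n 1 * I) / (1 - n 2) : ℂ) : OnePoint ℂ)

/-- The stereographic projection `g` of the Gauss map. -/
def g (X : M → E3) (p : M) : OnePoint ℂ := stereo (gaussMap X p)

/-- The complex one-forms `φ_k = dx_k - i dx_k ∘ Rot`, evaluated at a tangent vector `v` at `p`. -/
def phi (X : M → E3) (k : Fin 3) (p : M) (v : ℂ) : ℂ :=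
  (d X p v k : ℂ) - I * (d X p (I * v) k : ℂ)

/-- The complex height differential `dh`. -/
def dh (X : M → E3) (p : M) (v : ℂ) : ℂ := phi X 2 p v

/-- The one-form `g dh`.  It is the product where `g` is finite; at the poles of `g`, where `dh`
vanishes, it has the value of the continuous extension `-(φ₁ + i φ₂)` (see `gdh_eq`). -/
def gdh (X : M → E3) (p : M) (v : ℂ) : ℂ :=
  match g X p with
  | none => -(phi X 0 p v + I * phi X 1 p v)
  | some z => z * dh X p v

/-- The one-form `g⁻¹ dh`.  It is the product where `g` is neither `0` nor `∞`, and `0` where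
`g = ∞` (there `g⁻¹ = 0`); at the zeros of `g`, where `dh` vanishes, it has the value of the
continuous extension `φ₁ - i φ₂` (see `ginvdh_eq`). -/
def ginvdh (X : M → E3) (p : M) (v : ℂ) : ℂ :=
  open Classical in
  match g X p with
  | none => 0
  | some z => if z = 0 then phi X 0 p v - I * phi X 1 p v else z⁻¹ * dh X p v

/-- The one-form `Φ_r = (½ (r⁻¹ g⁻¹ - r g), (i/2) (r⁻¹ g⁻¹ + r g), 1) dh` of the deformed
Weierstrass data `g_r = r g`, `dh_r = dh`. -/
def Phi (X : M → E3) (r : ℝ) (p : M) (v : ℂ) : Fin 3 → ℂ :=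
  ![(1 / 2) * ((r : ℂ)⁻¹ * ginvdh X p v - r * gdh X p v),
    (I / 2) * ((r : ℂ)⁻¹ * ginvdh X p v + r * gdh X p v),
    dh X p v]

/-! The forms `g dh` and `g⁻¹ dh` of a conformal immersion are the holomorphic forms
`-(φ₁ + i φ₂)` and `φ₁ - i φ₂` on all of `M`. -/

theorem phi_eq (X : M → E3) (k : Fin 3) (p : M) (v : ℂ) :
    phi X k p v = v * ((d X p 1 k : ℂ) - I * (d X p I k : ℂ)) := by
  have h1 : d X p v = v.re • d X p 1 + v.im • d X p I := by
    rw [← map_smul, ← map_smul, ← map_add]; congr 1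
    apply Complex.ext <;> simp
  have h2 : d X p (I * v) = (-v.im) • d X p 1 + v.re • d X p I := by
    rw [← map_smul, ← map_smul, ← map_add]; congr 1
    apply Complex.ext <;> simp
  simp only [phi, h1, h2, PiLp.add_apply, PiLp.smul_apply, smul_eq_mul]
  apply Complex.ext <;> simp [add_comm]

/-- The positively oriented frame `∂X/∂u`, `∂X/∂v`, `N` of a conformal map. -/
theorem frame {X : M → E3} {p : M} (h : IsConformalMap (d X p)) :
    let A := d X p 1
    let B := d X p I
    let n := gaussMap X p
    n 0 ^ 2 + n 1 ^ 2 + n 2 ^ 2 = 1 ∧ n 0 * A 0 + n 1 * A 1 + n 2 * A 2 = 0 ∧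
    B 0 = n 1 * A 2 - n 2 * A 1 ∧ B 1 = n 2 * A 0 - n 0 * A 2 ∧
      B 2 = n 0 * A 1 - n 1 * A 0 := by
  intro A B n
  obtain ⟨c, hc, li, hli⟩ := h
  have hA : A = c • li 1 := by simp [A, hli]
  have hB : B = c • li I := by simp [B, hli]
  have e1 : inner ℝ A A = c ^ 2 := by
    rw [hA, inner_smul_left, inner_smul_right, li.inner_map_map]; simp; ring
  have e2 : inner ℝ B B = c ^ 2 := by
    rw [hB, inner_smul_left, inner_smul_right, li.inner_map_map]; simp; ring
  have e3 : inner ℝ A B = 0 := by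
    rw [hA, hB, inner_smul_left, inner_smul_right, li.inner_map_map]; simp
  simp only [PiLp.inner_apply, Fin.sum_univ_three, RCLike.inner_apply, conj_trivial] at e1 e2 e3
  have hC0 : cross A B 0 = A 1 * B 2 - A 2 * B 1 := by simp [cross, crossProduct]
  have hC1 : cross A B 1 = A 2 * B 0 - A 0 * B 2 := by simp [cross, crossProduct]
  have hC2 : cross A B 2 = A 0 * B 1 - A 1 * B 0 := by simp [cross, crossProduct]
  have hc2 : 0 < c ^ 2 := by positivity
  have hn : ‖cross A B‖ = c ^ 2 := by
    rw [EuclideanSpace.norm_eq, Real.sqrt_eq_iff_mul_self_eq_of_pos hc2]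
    simp only [Fin.sum_univ_three, Real.norm_eq_abs, sq_abs, hC0, hC1, hC2]
    linear_combination (-c ^ 2) * e1 - (A 0 * A 0 + A 1 * A 1 + A 2 * A 2) * e2
      + (B 0 * A 0 + B 1 * A 1 + B 2 * A 2) * e3
  have hN : ∀ k, n k = (c ^ 2)⁻¹ * cross A B k := by
    intro k; simp only [n, gaussMap]; change (‖cross A B‖⁻¹ • cross A B) k = _
    rw [hn]; rfl
  have hN0 : c ^ 2 * n 0 = A 1 * B 2 - A 2 * B 1 := by
    rw [hN, hC0, mul_inv_cancel_left₀ hc2.ne']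
  have hN1 : c ^ 2 * n 1 = A 2 * B 0 - A 0 * B 2 := by
    rw [hN, hC1, mul_inv_cancel_left₀ hc2.ne']
  have hN2 : c ^ 2 * n 2 = A 0 * B 1 - A 1 * B 0 := by
    rw [hN, hC2, mul_inv_cancel_left₀ hc2.ne']
  have q0 : B 0 = n 1 * A 2 - n 2 * A 1 := by
    apply mul_left_cancel₀ hc2.ne'
    linear_combination (-B 0) * e1 + A 0 * e3 - A 2 * hN1 + A 1 * hN2
  have q1 : B 1 = n 2 * A 0 - n 0 * A 2 := by
    apply mul_left_cancel₀ hc2.ne'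
    linear_combination (-B 1) * e1 + A 1 * e3 - A 0 * hN2 + A 2 * hN0
  have q2 : B 2 = n 0 * A 1 - n 1 * A 0 := by
    apply mul_left_cancel₀ hc2.ne'
    linear_combination (-B 2) * e1 + A 2 * e3 - A 1 * hN0 + A 0 * hN1
  refine ⟨?_, ?_, q0, q1, q2⟩
  · apply mul_left_cancel₀ hc2.ne'
    linear_combination n 0 * hN0 + n 1 * hN1 + n 2 * hN2 - B 0 * q0 - B 1 * q1 - B 2 * q2 + e2
  · apply mul_left_cancel₀ hc2.ne'
    linear_combination A 0 * hN0 + A 1 * hN1 + A 2 * hN2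

/-- The value of `g` at a point where it is finite. -/
theorem g_eq_some {X : M → E3} {p : M} {z : ℂ} (hz : g X p = some z) :
    (1 : ℂ) - gaussMap X p 2 ≠ 0 ∧
      z * (1 - gaussMap X p 2) = gaussMap X p 0 + gaussMap X p 1 * I := by
  have hne : gaussMap X p 2 ≠ 1 := by
    intro h1
    simp only [g, stereo, h1, if_true] at hz
    exact OnePoint.infty_ne_coe z hz
  have h1 : (1 : ℂ) - gaussMap X p 2 ≠ 0 := by
    intro h; apply hne; exact_mod_cast (sub_eq_zero.1 h).symm
  simp only [g, stereo, hne, if_false] at hz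
  refine ⟨h1, ?_⟩
  rw [← OnePoint.coe_injective hz, div_mul_cancel₀ _ h1]

theorem gdh_eq {X : M → E3} {p : M} (h : IsConformalMap (d X p)) (v : ℂ) :
    gdh X p v = -(phi X 0 p v + I * phi X 1 p v) := by
  unfold gdh
  split
  · rfl
  · rename_i z hz
    obtain ⟨h1, h2⟩ := g_eq_some hz
    obtain ⟨hn, hA, h3, h4, h5⟩ := frame h
    have hn' := congrArg (fun x : ℝ => (x : ℂ)) hn
    have hA' := congrArg (fun x : ℝ => (x : ℂ)) hA
    apply mul_left_cancel₀ h1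
    rw [dh, phi_eq, phi_eq, phi_eq, h3, h4, h5]
    push_cast at hn' hA' ⊢
    set n := gaussMap X p
    set A := d X p 1
    linear_combination v * (A 2 - I * (n 0 * A 1 - n 1 * A 0)) * h2
      - v * (A 0 + I * A 1) * hn' + v * (n 0 + I * n 1) * hA'
      - v * (n 1 * (n 0 * A 1 - n 1 * A 0) + (1 - n 2) * (n 2 * A 0 - n 0 * A 2)) * I_sq

theorem ginvdh_eq {X : M → E3} {p : M} (h : IsConformalMap (d X p)) (v : ℂ) :
    ginvdh X p v = phi X 0 p v - I * phi X 1 p v := by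
  obtain ⟨hn, hA, h3, h4, h5⟩ := frame h
  unfold ginvdh
  split
  · rename_i hz
    have h2 : gaussMap X p 2 = 1 := by
      by_contra hne
      simp only [g, stereo, hne, if_false] at hz
      exact OnePoint.coe_ne_infty _ hz
    rw [h2] at hn
    have h0 : gaussMap X p 0 = 0 := by nlinarith [sq_nonneg (gaussMap X p 1)]
    have h1 : gaussMap X p 1 = 0 := by nlinarith [sq_nonneg (gaussMap X p 0)]
    rw [phi_eq, phi_eq, h3, h4, h0, h1, h2]
    push_cast
    linear_combination (-v * (d X p 1 0 : ℂ)) * I_sq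
  · rename_i z hz
    split_ifs with h0
    · rfl
    obtain ⟨h1, h2⟩ := g_eq_some hz
    apply mul_left_cancel₀ h1
    have hn' := congrArg (fun x : ℝ => (x : ℂ)) hn
    have hA' := congrArg (fun x : ℝ => (x : ℂ)) hA
    rw [← mul_assoc, mul_comm _ z⁻¹, mul_assoc, inv_mul_eq_iff_eq_mul₀ h0, ← mul_assoc]
    rw [dh, phi_eq, phi_eq, phi_eq, h3, h4, h5, h2]
    push_cast at hn' hA' ⊢
    set n := gaussMap X p
    set A := d X p 1
    linear_combination (-v * A 2) * hn' - v * (1 - n 2) * hA'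
      + v * (-n 2 * n 0 * A 0 - n 2 * A 1 * n 1 - n 2 * I * n 1 * A 0 + A 2 * I * n 0 * n 1
        + A 2 * n 0 ^ 2 + A 2 * n 1 ^ 2 + A 1 * n 1) * I_sq

/-- `Re Φ_r`, the differential of the (possibly multi-valued) map `X_r = Re ∫ Φ_r`. -/
def rePhi (X : M → E3) (r : ℝ) (p : M) (v : ℂ) : E3 :=
  WithLp.toLp 2 fun k => (Phi X r p v k).re

/-- For `r = 1` the form `Re Φ_r` is the differential of `X`. -/
theorem rePhi_one {X : M → E3} {p : M} (h : IsConformalMap (d X p)) (v : ℂ) :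
    rePhi X 1 p v = d X p v := by
  have e : ∀ k, (phi X k p v).re = d X p v k := fun k => by simp [phi]
  ext k
  rw [← e k]
  fin_cases k <;> simp [rePhi, Phi, gdh_eq h, ginvdh_eq h, dh] <;> ring

/-- `Y : M → ℝ³` is the deformation `X_r = Re ∫ Φ_r`, as a single-valued map (which is determined
up to a translation): its increment along every curve is the integral of `Re Φ_r`. -/
def IsDeformation (X : M → E3) (r : ℝ) (Y : M → E3) : Prop :=
  ∀ γ : ℝ → M, IsCurve γ →
    Y (γ 1) - Y (γ 0) = ∫ t in (0 : ℝ)..1, rePhi X r (γ t) (velocity γ t)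

/-- The deformation `X_r` is single-valued. -/
def IsSingleValued (X : M → E3) (r : ℝ) : Prop :=
  ∃ Y : M → E3, IsDeformation X r Y

/-- The (possibly multi-valued) deformation `X_r` is complete. -/
def IsCompleteDeformation (X : M → E3) (r : ℝ) : Prop :=
  IsCompleteForm (rePhi X r)

end LopezRos

end

open scoped Manifold ContDiff Topology

noncomputable section

namespace LopezRos

open MeasureTheory Set Filter Complex

/-! Let n be the unit normal at a point and k = (r + r⁻¹)/2 + (r - r⁻¹)/2 · n 2. Since φ_j = dx_j -
i (n × dX)_j, the form Re Φ_r is pointwise a linear image of dX (`rePhi_eq_deform`), and on the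
plane orthogonal to n this linear map is a similarity of ratio k (`norm_deform`). As |n 2| ≤ 1, k
stays between `min r r⁻¹` and `max r r⁻¹`, so ds_r = k ds is uniformly comparable to ds; this gives
completeness.

The Gauss map of X_r is that of X followed by the conformal map of the sphere induced by z ↦ r z,
whose ratio at n is k⁻¹. Hence dA_r = k² dA and K_r = k⁻⁴ K (`gaussCurvature_deformed`), so |K_r|
dA_r = k⁻² |K| dA, again comparable with bounded ratio.

The horizontal coordinates of Re Φ_r are (r + r⁻¹)/2 times those of dX, which is exact, plus (r -
r⁻¹)/2 times the horizontal part of n × dX turned by a right angle; the vertical coordinate is that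
of dX. So the period over a closed curve with flux F is (r - r⁻¹)/2 · (F 1, -F 0, 0)
(`lineIntegral_deform_of_closed`). Vanishing periods yield a primitive (`exists_primitive`);
conversely `d_primitive` recovers the differential of a deformation known only by its increments. -/

/-! ### Vector algebra in three-space -/

theorem cross_apply_zero (v w : E3) : cross v w 0 = v 1 * w 2 - v 2 * w 1 := by
  simp [cross, crossProduct]

theorem cross_apply_one (v w : E3) : cross v w 1 = v 2 * w 0 - v 0 * w 2 := by
  simp [cross, crossProduct]

theorem cross_apply_two (v w : E3) : cross v w 2 = v 0 * w 1 - v 1 * w 0 := by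
  simp [cross, crossProduct]

theorem inner_eq (v w : E3) : inner ℝ v w = v 0 * w 0 + v 1 * w 1 + v 2 * w 2 := by
  simp [PiLp.inner_apply, Fin.sum_univ_three, mul_comm]

theorem ext_three {v w : E3} (h0 : v 0 = w 0) (h1 : v 1 = w 1) (h2 : v 2 = w 2) : v = w := by
  ext k; fin_cases k <;> assumption

theorem cross_smul_right (t : ℝ) (v w : E3) : cross v (t • w) = t • cross v w := by
  apply ext_three <;>
    simp only [cross_apply_zero, cross_apply_one, cross_apply_two, PiLp.smul_apply, smul_eq_mul] <;>
    ring

theorem cross_add_right (u v w : E3) : cross u (v + w) = cross u v + cross u w := by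
  apply ext_three <;>
    simp only [cross_apply_zero, cross_apply_one, cross_apply_two, PiLp.add_apply] <;> ring

theorem inner_cross_left (v w : E3) : inner ℝ (cross v w) v = 0 := by
  simp only [inner_eq, cross_apply_zero, cross_apply_one, cross_apply_two]; ring

/-- The Cauchy–Binet identity. -/
theorem inner_cross_cross (a b v w : E3) :
    inner ℝ (cross a b) (cross v w) =
      inner ℝ a v * inner ℝ b w - inner ℝ a w * inner ℝ b v := by
  simp only [inner_eq, cross_apply_zero, cross_apply_one, cross_apply_two]; ring

/-- The vector product of two vectors orthogonal to a unit vector is a multiple of it. -/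
theorem cross_eq_smul {n a b : E3} (hn : ‖n‖ = 1) (ha : inner ℝ n a = 0) (hb : inner ℝ n b = 0) :
    cross a b = inner ℝ (cross a b) n • n := by
  have hn' : inner ℝ n n = 1 := by rw [real_inner_self_eq_norm_sq, hn]; norm_num
  simp only [inner_eq] at hn' ha hb
  apply ext_three <;>
    simp only [inner_eq, PiLp.smul_apply, smul_eq_mul, cross_apply_zero, cross_apply_one,
      cross_apply_two]
  · linear_combination (-(a 1 * b 2 - a 2 * b 1)) * hn' + (n 1 * b 2 - n 2 * b 1) * ha
      - (n 1 * a 2 - n 2 * a 1) * hb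
  · linear_combination (-(a 2 * b 0 - a 0 * b 2)) * hn' + (n 2 * b 0 - n 0 * b 2) * ha
      - (n 2 * a 0 - n 0 * a 2) * hb
  · linear_combination (-(a 0 * b 1 - a 1 * b 0)) * hn' + (n 0 * b 1 - n 1 * b 0) * ha
      - (n 0 * a 1 - n 1 * a 0) * hb

theorem continuous_cross : Continuous fun x : E3 × E3 => cross x.1 x.2 := by
  apply (PiLp.continuous_toLp 2 _).comp
  refine continuous_pi fun k => ?_
  fin_cases k <;> simp [crossProduct] <;> fun_prop

theorem contDiff_cross {n : WithTop ℕ∞} : ContDiff ℝ n fun x : E3 × E3 => cross x.1 x.2 := by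
  rw [contDiff_euclidean]
  intro k
  have h : ∀ i : Fin 3, ContDiff ℝ n fun x : E3 × E3 => x.1 i := fun i =>
    (contDiff_euclidean.1 contDiff_fst) i
  have h' : ∀ i : Fin 3, ContDiff ℝ n fun x : E3 × E3 => x.2 i := fun i =>
    (contDiff_euclidean.1 contDiff_snd) i
  fin_cases k
  · simpa only [cross_apply_zero] using! ((h 1).mul (h' 2)).sub ((h 2).mul (h' 1))
  · simpa only [cross_apply_one] using! ((h 2).mul (h' 0)).sub ((h 0).mul (h' 2))
  · simpa only [cross_apply_two] using! ((h 0).mul (h' 1)).sub ((h 1).mul (h' 0))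

/-! ### The pointwise deformation -/

/-- The scaling factor of the deformation over a point with unit normal `n`. -/
def factor (r : ℝ) (n : E3) : ℝ := (r + r⁻¹) / 2 + (r - r⁻¹) / 2 * n 2

/-- The linear map that takes the differential of `X` to that of its deformation, over a point with
unit normal `n`. -/
def deform (r : ℝ) (n : E3) : E3 →L[ℝ] E3 :=
  LinearMap.toContinuousLinearMap
    { toFun := fun a => !₂[factor r n * a 0 - (r - r⁻¹) / 2 * n 0 * a 2,
        factor r n * a 1 - (r - r⁻¹) / 2 * n 1 * a 2, a 2]
      map_add' := fun a b => by apply ext_three <;> simp <;> ring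
      map_smul' := fun t a => by apply ext_three <;> simp <;> ring }

theorem deform_apply_zero (r : ℝ) (n a : E3) :
    deform r n a 0 = factor r n * a 0 - (r - r⁻¹) / 2 * n 0 * a 2 := by simp [deform]

theorem deform_apply_one (r : ℝ) (n a : E3) :
    deform r n a 1 = factor r n * a 1 - (r - r⁻¹) / 2 * n 1 * a 2 := by simp [deform]

theorem deform_apply_two (r : ℝ) (n a : E3) : deform r n a 2 = a 2 := by simp [deform]

/-- The action of the Möbius transformation `z ↦ r z` on the unit sphere, before normalization. -/
def moebiusNum (r : ℝ) (n : E3) : E3 := !₂[n 0, n 1, (r - r⁻¹) / 2 + (r + r⁻¹) / 2 * n 2]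

theorem moebiusNum_apply_zero (r : ℝ) (n : E3) : moebiusNum r n 0 = n 0 := rfl

theorem moebiusNum_apply_one (r : ℝ) (n : E3) : moebiusNum r n 1 = n 1 := rfl

theorem moebiusNum_apply_two (r : ℝ) (n : E3) :
    moebiusNum r n 2 = (r - r⁻¹) / 2 + (r + r⁻¹) / 2 * n 2 := rfl

theorem abs_apply_two_le {n : E3} (hn : ‖n‖ = 1) : |n 2| ≤ 1 :=
  hn ▸ PiLp.norm_apply_le n 2

/-- The factor is affine in `n 2 ∈ [-1, 1]`, with value `r⁻¹` at the south pole and `r` at the north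
pole. -/
theorem factor_lower {r : ℝ} {n : E3} (hn : ‖n‖ = 1) : min r r⁻¹ ≤ factor r n := by
  obtain ⟨h1, h2⟩ := abs_le.1 (abs_apply_two_le hn)
  unfold factor
  rcases le_total r r⁻¹ with h | h
  · rw [min_eq_left h]; nlinarith
  · rw [min_eq_right h]; nlinarith

theorem factor_upper {r : ℝ} {n : E3} (hn : ‖n‖ = 1) : factor r n ≤ max r r⁻¹ := by
  obtain ⟨h1, h2⟩ := abs_le.1 (abs_apply_two_le hn)
  unfold factor
  rcases le_total r r⁻¹ with h | h
  · rw [max_eq_right h]; nlinarith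
  · rw [max_eq_left h]; nlinarith

theorem factor_pos {r : ℝ} (hr : 0 < r) {n : E3} (hn : ‖n‖ = 1) : 0 < factor r n :=
  (lt_min hr (inv_pos.2 hr)).trans_le (factor_lower hn)

/-- With c = (r + r⁻¹)/2 and s = (r - r⁻¹)/2 one has c² - s² = 1, and (`factor r n`, `moebiusNum r
n`) is the image of the null vector (1, n) under the Lorentz boost with hyperbolic cosine c and sine
s. The image is null too. -/
theorem norm_moebiusNum {r : ℝ} (hr : 0 < r) {n : E3} (hn : ‖n‖ = 1) :
    ‖moebiusNum r n‖ = factor r n := by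
  have hn' : inner ℝ n n = 1 := by rw [real_inner_self_eq_norm_sq, hn]; norm_num
  rw [← sq_eq_sq₀ (norm_nonneg _) (factor_pos hr hn).le, ← real_inner_self_eq_norm_sq]
  simp only [inner_eq, moebiusNum_apply_zero, moebiusNum_apply_one, moebiusNum_apply_two,
    factor] at hn' ⊢
  have := mul_inv_cancel₀ hr.ne'
  linear_combination hn' + (n 2 ^ 2 - 1) * this

theorem norm_deform {r : ℝ} (hr : 0 < r) {n a : E3} (hn : ‖n‖ = 1) (ha : inner ℝ n a = 0) :
    ‖deform r n a‖ = factor r n * ‖a‖ := by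
  have hn' : inner ℝ n n = 1 := by rw [real_inner_self_eq_norm_sq, hn]; norm_num
  have hk := factor_pos hr hn
  rw [← sq_eq_sq₀ (norm_nonneg _) (by positivity), mul_pow, ← real_inner_self_eq_norm_sq,
    ← real_inner_self_eq_norm_sq]
  simp only [inner_eq, deform_apply_zero, deform_apply_one, deform_apply_two] at hn' ha ⊢
  set k := factor r n with hkd
  have hr' := mul_inv_cancel₀ hr.ne'
  have hk' : k = (r + r⁻¹) / 2 + (r - r⁻¹) / 2 * n 2 := rfl
  set s := (r - r⁻¹) / 2 with hs
  -- This is c² - s² = 1. It cancels the surplus `a 2 ^ 2` terms left after orthogonality replaces n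
  -- 0 a 0 + n 1 a 1 by -n 2 a 2.
  have hc : (k - s * n 2) ^ 2 - s ^ 2 = 1 := by
    rw [hk', hs]; linear_combination hr'
  linear_combination (-2 * k * s * a 2) * ha + (s ^ 2 * a 2 ^ 2) * hn' - a 2 ^ 2 * hc

/-- This yields both the new normal direction and, by `norm_moebiusNum`, the area ratio `factor r n
^ 2`. -/
theorem cross_deform {r : ℝ} {n a b : E3} {t : ℝ} (hn : ‖n‖ = 1) (h : cross a b = t • n) :
    cross (deform r n a) (deform r n b) = (factor r n * t) • moebiusNum r n := by
  have hn' : inner ℝ n n = 1 := by rw [real_inner_self_eq_norm_sq, hn]; norm_num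
  have h0 : a 1 * b 2 - a 2 * b 1 = t * n 0 := by rw [← cross_apply_zero, h]; rfl
  have h1 : a 2 * b 0 - a 0 * b 2 = t * n 1 := by rw [← cross_apply_one, h]; rfl
  have h2 : a 0 * b 1 - a 1 * b 0 = t * n 2 := by rw [← cross_apply_two, h]; rfl
  rw [inner_eq] at hn'
  have hk' : factor r n = (r + r⁻¹) / 2 + (r - r⁻¹) / 2 * n 2 := rfl
  set k := factor r n
  set s := (r - r⁻¹) / 2
  set c := (r + r⁻¹) / 2
  apply ext_three <;>
    simp only [cross_apply_zero, cross_apply_one, cross_apply_two, deform_apply_zero,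
      deform_apply_one, deform_apply_two, PiLp.smul_apply, smul_eq_mul, moebiusNum_apply_zero,
      moebiusNum_apply_one, moebiusNum_apply_two]
  · linear_combination k * h0
  · linear_combination k * h1
  · linear_combination k ^ 2 * h2 + k * s * (n 0 * h0 + n 1 * h1) + k * t * s * hn' + k * t * n 2 * hk'

theorem continuous_factor (r : ℝ) : Continuous (factor r) := by
  unfold factor; fun_prop

theorem continuous_deform (r : ℝ) : Continuous (deform r) := by
  rw [continuous_clm_apply]
  intro a
  have := continuous_factor r
  apply (PiLp.continuous_toLp 2 _).comp
  refine continuous_pi fun k => ?_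
  fin_cases k <;> simp <;> fun_prop

/-! ### The deformed form as a linear image of the differential -/

variable {M : Type*} [TopologicalSpace M] [ChartedSpace ℂ M] {X : M → E3} {p : M}

theorem norm_gaussMap (h : IsConformalMap (d X p)) : ‖gaussMap X p‖ = 1 := by
  obtain ⟨h1, -⟩ := frame h
  have : inner ℝ (gaussMap X p) (gaussMap X p) = 1 := by rw [inner_eq, ← h1]; ring
  rw [real_inner_self_eq_norm_sq] at this
  exact (pow_eq_one_iff_of_nonneg (norm_nonneg _) two_ne_zero).1 this

theorem d_eq_add (X : M → E3) (p : M) (v : ℂ) : d X p v = v.re • d X p 1 + v.im • d X p I := by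
  rw [← map_smul, ← map_smul, ← map_add]; congr 1
  apply Complex.ext <;> simp

/-- A conformal differential intertwines the complex structure with rotation by a right angle about
the normal. Imaginary parts of the φ_j thereby become coordinates of N × dX. -/
theorem d_I_mul (h : IsConformalMap (d X p)) (v : ℂ) :
    d X p (I * v) = cross (gaussMap X p) (d X p v) := by
  obtain ⟨hn, hA, h3, h4, h5⟩ := frame h
  rw [d_eq_add X p v, d_eq_add X p (I * v)]
  set n := gaussMap X p
  set A := d X p 1
  set B := d X p I
  apply ext_three <;>
    simp only [cross_apply_zero, cross_apply_one, cross_apply_two, PiLp.add_apply,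
      PiLp.smul_apply, smul_eq_mul, mul_re, mul_im, I_re, I_im, h3, h4, h5]
  · linear_combination v.im * A 0 * hn - v.im * n 0 * hA
  · linear_combination v.im * A 1 * hn - v.im * n 1 * hA
  · linear_combination v.im * A 2 * hn - v.im * n 2 * hA

theorem inner_gaussMap_d (h : IsConformalMap (d X p)) (v : ℂ) :
    inner ℝ (gaussMap X p) (d X p v) = 0 := by
  have h1 : d X p v = - d X p (I * (I * v)) := by
    rw [← map_neg]; congr 1; linear_combination v * I_sq
  rw [h1, d_I_mul h, inner_neg_right, real_inner_comm, inner_cross_left, neg_zero]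

/-- Substituting g dh = -(φ₁ + i φ₂) and g⁻¹ dh = φ₁ - i φ₂ removes the poles and zeros of g from
the formula; what remains is linear in dX and N × dX. -/
theorem rePhi_eq_deform (h : IsConformalMap (d X p)) (r : ℝ) (v : ℂ) :
    rePhi X r p v = deform r (gaussMap X p) (d X p v) := by
  have e0 : ∀ k, (phi X k p v).re = d X p v k := fun k => by simp [phi]
  have e1 : ∀ k, (phi X k p v).im = -cross (gaussMap X p) (d X p v) k := fun k => by
    rw [← d_I_mul h]; simp [phi]
  have i0 : (I / 2).re = 0 := by simp
  have i1 : (I / 2).im = 1 / 2 := by simp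
  have i2 : ((1 : ℂ) / 2).re = 1 / 2 := by simp
  have i3 : ((1 : ℂ) / 2).im = 0 := by simp
  apply ext_three
  · simp [rePhi, Phi, gdh_eq h, ginvdh_eq h, e0, e1, deform_apply_zero, cross_apply_one, factor,
      ← ofReal_inv]
    ring
  · simp [rePhi, Phi, gdh_eq h, ginvdh_eq h, e0, e1, deform_apply_one, cross_apply_zero, factor,
      i0, i1, ← ofReal_inv]
    ring
  · simp [rePhi, Phi, dh, e0, deform_apply_two]

/-! ### Differentials in charts and regularity of the Gauss map -/

theorem isManifold_real (M : Type*) [TopologicalSpace M] [ChartedSpace ℂ M] [IsManifold 𝓘(ℂ) ω M]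
    (n : WithTop ℕ∞) : IsManifold 𝓘(ℝ, ℂ) n M := by
  apply isManifold_of_contDiffOn
  intro e e' he he'
  have h := (contDiffGroupoid ω 𝓘(ℂ)).compatible he he'
  rw [contDiffGroupoid, mem_groupoid_of_pregroupoid] at h
  have h1 : ContDiffOn ℂ ω (e.symm ≫ₕ e') (e.symm ≫ₕ e').source := by
    simpa [contDiffPregroupoid] using h.1
  have h2 := (h1.restrict_scalars ℝ).of_le (show n ≤ ω from le_top)
  simpa using h2

theorem cross_d_ne_zero {p : M} (h : IsConformalMap (d X p)) : cross (d X p 1) (d X p I) ≠ 0 := by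
  intro h0
  have := norm_gaussMap h
  rw [gaussMap, h0] at this
  simp at this

theorem d_eq_fderiv {q : M} (hX : MDifferentiableAt 𝓘(ℝ, ℂ) 𝓘(ℝ, E3) X q) :
    d X q = fderiv ℝ (X ∘ (chartAt ℂ q).symm) (chartAt ℂ q q) := by
  simp only [d, mfderiv, hX, writtenInExtChartAt]
  simp
  rfl

theorem d_of_hasFDerivAt {q : M} (hc : ContinuousAt X q) {A : ℂ →L[ℝ] E3}
    (h : HasFDerivAt (X ∘ (chartAt ℂ q).symm) A (chartAt ℂ q q)) :
    HasMFDerivAt 𝓘(ℝ, ℂ) 𝓘(ℝ, E3) X q A := by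
  refine ⟨hc, ?_⟩
  simp only [writtenInExtChartAt]
  simp only [mfld_simps]
  exact h.hasFDerivWithinAt

section Charts

variable [IsManifold 𝓘(ℂ) ω M]

theorem differentiableAt_transition {e e' : OpenPartialHomeomorph M ℂ} (he : e ∈ atlas ℂ M)
    (he' : e' ∈ atlas ℂ M) {q : M} (hq : q ∈ e.source) (hq' : q ∈ e'.source) :
    DifferentiableAt ℂ (e' ∘ e.symm) (e q) := by
  have h := (contDiffGroupoid ω 𝓘(ℂ)).compatible he he'
  rw [contDiffGroupoid, mem_groupoid_of_pregroupoid] at h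
  have h1 : ContDiffOn ℂ ω (e.symm ≫ₕ e') (e.symm ≫ₕ e').source := by
    simpa [contDiffPregroupoid] using h.1
  have h2 : e q ∈ (e.symm ≫ₕ e').source := by simp [hq, hq']
  exact ((h1.differentiableOn (by simp)) _ h2).differentiableAt
    ((e.symm ≫ₕ e').open_source.mem_nhds h2)

theorem contDiffOn_comp_symm {n : WithTop ℕ∞} (hX : ContMDiff 𝓘(ℝ, ℂ) 𝓘(ℝ, E3) n X)
    {e : OpenPartialHomeomorph M ℂ} (he : e ∈ atlas ℂ M) :
    ContDiffOn ℝ n (X ∘ e.symm) e.target := by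
  have := isManifold_real M n
  rw [← contMDiffOn_iff_contDiffOn]
  exact hX.comp_contMDiffOn
    (contMDiffOn_symm_of_mem_maximalAtlas (IsManifold.subset_maximalAtlas he))

/-- The differential in terms of an arbitrary chart. -/
theorem exists_d_eq {e : OpenPartialHomeomorph M ℂ} (he : e ∈ atlas ℂ M) {q : M}
    (hq : q ∈ e.source) : ∃ l : ℂ, l ≠ 0 ∧ ∀ X : M → E3, ContMDiff 𝓘(ℝ, ℂ) 𝓘(ℝ, E3) 1 X →
      ∀ v, d X q v = fderiv ℝ (X ∘ e.symm) (e q) (l * v) := by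
  set c := chartAt ℂ q
  have hc : c ∈ atlas ℂ M := chart_mem_atlas ℂ q
  have hqc : q ∈ c.source := mem_chart_source ℂ q
  have h1 := differentiableAt_transition hc he hqc hq
  have h2 := differentiableAt_transition he hc hq hqc
  have hmem : ∀ᶠ z in 𝓝 (c q), z ∈ c.target ∧ c.symm z ∈ e.source := by
    have h3 : c q ∈ c.target := c.map_source hqc
    refine Filter.Eventually.and (c.open_target.mem_nhds h3) ?_
    have : ContinuousAt c.symm (c q) := c.continuousAt_symm h3
    apply this.eventually_mem
    rw [c.left_inv hqc]
    exact e.open_source.mem_nhds hq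
  -- The derivative of the transition map: a complex number because charts are holomorphically
  -- compatible, independent of X, and nonzero because the transition has a differentiable inverse.
  refine ⟨deriv (e ∘ c.symm) (c q), ?_, ?_⟩
  · intro h0
    have hid : (c ∘ e.symm) ∘ (e ∘ c.symm) =ᶠ[𝓝 (c q)] id := by
      filter_upwards [hmem] with z hz
      simp [e.left_inv hz.2, c.right_inv hz.1]
    have hcomp : (e ∘ c.symm) (c q) = e q := by simp [c.left_inv hqc]
    have hd := hid.deriv_eq
    rw [deriv_comp _ (by rwa [hcomp]) h1, h0, mul_zero, deriv_id] at hd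
    exact zero_ne_one hd
  · intro X hX v
    have hXe : DifferentiableAt ℝ (X ∘ e.symm) (e q) :=
      ((contDiffOn_comp_symm hX he).differentiableOn (by simp) _ (e.map_source hq)).differentiableAt
        (e.open_target.mem_nhds (e.map_source hq))
    rw [d_eq_fderiv ((hX q).mdifferentiableAt (by simp))]
    have heq : X ∘ c.symm =ᶠ[𝓝 (c q)] (X ∘ e.symm) ∘ (e ∘ c.symm) := by
      filter_upwards [hmem] with z hz
      simp [e.left_inv hz.2]
    have hcomp : (e ∘ c.symm) (c q) = e q := by simp [c.left_inv hqc]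
    have h3 : HasFDerivAt (e ∘ c.symm)
        ((ContinuousLinearMap.toSpanSingleton ℂ (deriv (e ∘ c.symm) (c q))).restrictScalars ℝ)
        (c q) := h1.hasDerivAt.hasFDerivAt.restrictScalars ℝ
    rw [← hcomp] at hXe
    have := (hXe.hasFDerivAt.comp (c q) h3).congr_of_eventuallyEq heq
    rw [this.fderiv, hcomp]
    simp [mul_comm]

theorem cross_mul_I (A : ℂ →L[ℝ] E3) (l : ℂ) :
    cross (A (l * 1)) (A (l * I)) = ‖l‖ ^ 2 • cross (A 1) (A I) := by
  have h : ∀ v, A v = v.re • A 1 + v.im • A I := fun v => by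
    rw [← map_smul, ← map_smul, ← map_add]; congr 1
    apply Complex.ext <;> simp
  rw [h (l * 1), h (l * I), ← Complex.normSq_eq_norm_sq, normSq_apply]
  apply ext_three <;>
    simp only [cross_apply_zero, cross_apply_one, cross_apply_two, PiLp.smul_apply,
      PiLp.add_apply, smul_eq_mul, mul_re, mul_im, I_re, I_im, one_re, one_im] <;> ring

/-- The normal `∂X/∂u × ∂X/∂v` in a chart; its norm is the density of the area measure. -/
def chartNormal (X : M → E3) (e : OpenPartialHomeomorph M ℂ) (z : ℂ) : E3 :=
  cross (fderiv ℝ (X ∘ e.symm) z 1) (fderiv ℝ (X ∘ e.symm) z I)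

theorem exists_cross_d_eq {e : OpenPartialHomeomorph M ℂ} (he : e ∈ atlas ℂ M) {q : M}
    (hq : q ∈ e.source) : ∃ t : ℝ, 0 < t ∧ ∀ X : M → E3, ContMDiff 𝓘(ℝ, ℂ) 𝓘(ℝ, E3) 1 X →
      cross (d X q 1) (d X q I) = t • chartNormal X e (e q) := by
  obtain ⟨l, hl, h⟩ := exists_d_eq he hq
  refine ⟨‖l‖ ^ 2, by positivity, fun X hX => ?_⟩
  rw [h X hX, h X hX, cross_mul_I, chartNormal]

/-- Changing the chart scales the normal by a positive number, which normalization removes. So the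
Gauss map, defined with the preferred chart of each point, can be read near a point in one fixed
chart, where its regularity is visible. -/
theorem gaussMap_eq_chart {e : OpenPartialHomeomorph M ℂ} (he : e ∈ atlas ℂ M) {q : M}
    (hq : q ∈ e.source) (hX : ContMDiff 𝓘(ℝ, ℂ) 𝓘(ℝ, E3) 1 X) :
    gaussMap X q = ‖chartNormal X e (e q)‖⁻¹ • chartNormal X e (e q) := by
  obtain ⟨t, ht, h⟩ := exists_cross_d_eq he hq
  rw [gaussMap, h X hX, norm_smul, Real.norm_of_nonneg ht.le, mul_inv, smul_smul, mul_right_comm,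
    inv_mul_cancel₀ ht.ne', one_mul]

theorem chartNormal_ne_zero {e : OpenPartialHomeomorph M ℂ} (he : e ∈ atlas ℂ M) {q : M}
    (hq : q ∈ e.source) (hX : ContMDiff 𝓘(ℝ, ℂ) 𝓘(ℝ, E3) 1 X) (h : IsConformalMap (d X q)) :
    chartNormal X e (e q) ≠ 0 := by
  obtain ⟨t, ht, h'⟩ := exists_cross_d_eq he hq
  intro h0
  apply cross_d_ne_zero h
  rw [h' X hX, h0, smul_zero]

theorem contMDiff_gaussMap (hX : ContMDiff 𝓘(ℝ, ℂ) 𝓘(ℝ, E3) 2 X)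
    (h : ∀ p, IsConformalMap (d X p)) : ContMDiff 𝓘(ℝ, ℂ) 𝓘(ℝ, E3) 1 (gaussMap X) := by
  have := isManifold_real M 1
  intro p
  have hX1 : ContMDiff 𝓘(ℝ, ℂ) 𝓘(ℝ, E3) 1 X := hX.of_le (by norm_num)
  set e := chartAt ℂ p
  have he : e ∈ atlas ℂ M := chart_mem_atlas ℂ p
  have hp : p ∈ e.source := mem_chart_source ℂ p
  have h1 : ContDiffAt ℝ 1 (fderiv ℝ (X ∘ e.symm)) (e p) :=
    ((contDiffOn_comp_symm hX he).contDiffAt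
      (e.open_target.mem_nhds (e.map_source hp))).fderiv_right (by norm_num)
  have h2 : ContDiffAt ℝ 1 (chartNormal X e) (e p) :=
    (contDiff_cross (n := 1)).contDiffAt.comp (e p)
      ((h1.clm_apply contDiffAt_const).prodMk (h1.clm_apply contDiffAt_const))
  have hne := chartNormal_ne_zero he hp hX1 (h p)
  have h3 : ContDiffAt ℝ 1 (fun z => ‖chartNormal X e z‖⁻¹ • chartNormal X e z) (e p) :=
    ((h2.norm ℝ hne).inv (norm_ne_zero_iff.2 hne)).smul h2
  have h4 : ContMDiffAt 𝓘(ℝ, ℂ) 𝓘(ℝ, ℂ) 1 e p :=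
    contMDiffAt_of_mem_maximalAtlas (IsManifold.subset_maximalAtlas he) hp
  refine (h3.contMDiffAt.comp p h4).congr_of_eventuallyEq ?_
  filter_upwards [e.open_source.mem_nhds hp] with q hq
  exact gaussMap_eq_chart he hq hX1

end Charts

/-! ### Line integrals along curves -/

/-- The integral along `γ` of the one-form `B ∘ dX`. -/
def lineIntegral (B : M → E3 →L[ℝ] E3) (X : M → E3) (γ : ℝ → M) : E3 :=
  ∫ t in (0 : ℝ)..1, B (γ t) (d X (γ t) (velocity γ t))

/-- The integrand of `lineIntegral`, extended continuously to the end points. -/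
def lineIntegrand (B : M → E3 →L[ℝ] E3) (X : M → E3) (γ : ℝ → M) (t : ℝ) : E3 :=
  B (γ t) (derivWithin (X ∘ γ) (Icc 0 1) t)

theorem d_velocity (hX : ContMDiff 𝓘(ℝ, ℂ) 𝓘(ℝ, E3) 1 X) {γ : ℝ → M} {t : ℝ}
    (hγ : ContMDiffAt 𝓘(ℝ, ℝ) 𝓘(ℝ, ℂ) 1 γ t) :
    d X (γ t) (velocity γ t) = deriv (X ∘ γ) t := by
  have h := mfderiv_comp t ((hX (γ t)).mdifferentiableAt (by simp))
    (hγ.mdifferentiableAt (by simp))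
  rw [mfderiv_eq_fderiv] at h
  rw [← fderiv_apply_one_eq_deriv, h]
  rfl

theorem IsCurve.contMDiffAt {γ : ℝ → M} (hγ : IsCurve γ) {t : ℝ} (ht : t ∈ Ioo (0 : ℝ) 1) :
    ContMDiffAt 𝓘(ℝ, ℝ) 𝓘(ℝ, ℂ) 1 γ t :=
  ContMDiffOn.contMDiffAt hγ (Icc_mem_nhds ht.1 ht.2)

theorem IsCurve.contDiffOn {γ : ℝ → M} (hγ : IsCurve γ)
    (hX : ContMDiff 𝓘(ℝ, ℂ) 𝓘(ℝ, E3) 1 X) : ContDiffOn ℝ 1 (X ∘ γ) (Icc 0 1) := by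
  rw [← contMDiffOn_iff_contDiffOn]
  exact hX.comp_contMDiffOn hγ

theorem IsCurve.continuousOn_lineIntegrand {γ : ℝ → M} (hγ : IsCurve γ)
    (hX : ContMDiff 𝓘(ℝ, ℂ) 𝓘(ℝ, E3) 1 X) {B : M → E3 →L[ℝ] E3} (hB : Continuous B) :
    ContinuousOn (lineIntegrand B X γ) (Icc 0 1) :=
  (hB.comp_continuousOn (ContMDiffOn.continuousOn hγ)).clm_apply
    ((hγ.contDiffOn hX).continuousOn_derivWithin (uniqueDiffOn_Icc zero_lt_one) le_rfl)

theorem IsCurve.lineIntegrand_eq {γ : ℝ → M} (hγ : IsCurve γ)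
    (hX : ContMDiff 𝓘(ℝ, ℂ) 𝓘(ℝ, E3) 1 X) (B : M → E3 →L[ℝ] E3) {t : ℝ}
    (ht : t ∈ Ioo (0 : ℝ) 1) :
    lineIntegrand B X γ t = B (γ t) (d X (γ t) (velocity γ t)) := by
  rw [d_velocity hX (hγ.contMDiffAt ht), lineIntegrand,
    derivWithin_of_mem_nhds (Icc_mem_nhds ht.1 ht.2)]

/-- At 0 and 1 the curve need only be differentiable from one side, so `velocity` may take the
default value 0 there; the two end points are negligible. -/
theorem IsCurve.ae_lineIntegrand_eq {γ : ℝ → M} (hγ : IsCurve γ)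
    (hX : ContMDiff 𝓘(ℝ, ℂ) 𝓘(ℝ, E3) 1 X) (B : M → E3 →L[ℝ] E3) :
    lineIntegrand B X γ =ᵐ[volume.restrict (uIoc 0 1)]
      fun t => B (γ t) (d X (γ t) (velocity γ t)) := by
  rw [uIoc_of_le zero_le_one, ← restrict_Ioo_eq_restrict_Ioc]
  filter_upwards [ae_restrict_mem measurableSet_Ioo] with t ht
  exact hγ.lineIntegrand_eq hX B ht

theorem IsCurve.lineIntegral_eq {γ : ℝ → M} (hγ : IsCurve γ)
    (hX : ContMDiff 𝓘(ℝ, ℂ) 𝓘(ℝ, E3) 1 X) (B : M → E3 →L[ℝ] E3) :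
    lineIntegral B X γ = ∫ t in (0 : ℝ)..1, lineIntegrand B X γ t :=
  (intervalIntegral.integral_congr_ae_restrict (hγ.ae_lineIntegrand_eq hX B)).symm

theorem IsCurve.intervalIntegrable {γ : ℝ → M} (hγ : IsCurve γ)
    (hX : ContMDiff 𝓘(ℝ, ℂ) 𝓘(ℝ, E3) 1 X) {B : M → E3 →L[ℝ] E3} (hB : Continuous B) :
    IntervalIntegrable (fun t => B (γ t) (d X (γ t) (velocity γ t))) volume 0 1 := by
  refine IntervalIntegrable.congr_ae ?_ (hγ.ae_lineIntegrand_eq hX B)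
  apply ContinuousOn.intervalIntegrable
  rw [uIcc_of_le zero_le_one]
  exact hγ.continuousOn_lineIntegrand hX hB

theorem IsCurve.lineIntegral_id {γ : ℝ → M} (hγ : IsCurve γ)
    (hX : ContMDiff 𝓘(ℝ, ℂ) 𝓘(ℝ, E3) 1 X) :
    ∫ t in (0 : ℝ)..1, d X (γ t) (velocity γ t) = X (γ 1) - X (γ 0) := by
  have hi := hγ.intervalIntegrable hX (B := fun _ => ContinuousLinearMap.id ℝ E3) continuous_const
  refine intervalIntegral.integral_eq_sub_of_hasDerivAt_of_le (f := X ∘ γ) zero_le_one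
    (hγ.contDiffOn hX).continuousOn (fun t ht => ?_) hi
  rw [d_velocity hX (hγ.contMDiffAt ht)]
  exact (((hγ.contDiffOn hX).contDiffAt (Icc_mem_nhds ht.1 ht.2)).differentiableAt
    (by simp)).hasDerivAt

/-! ### Reparametrization, concatenation and reversal -/

section Reparametrization

variable {γ : ℝ → M} {φ : ℝ → ℝ}

theorem IsCurve.contMDiff_comp (hγ : IsCurve γ) (hφ : ContDiff ℝ 1 φ)
    (h : ∀ t, φ t ∈ Icc (0 : ℝ) 1) : ContMDiff 𝓘(ℝ, ℝ) 𝓘(ℝ, ℂ) 1 (γ ∘ φ) := by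
  rw [← contMDiffOn_univ]
  exact ContMDiffOn.comp (t := Icc 0 1) hγ hφ.contMDiff.contMDiffOn (fun t _ => h t)

/-- Change of variables. Since φ maps the whole line into [0, 1], the one-sided derivative of `X ∘
γ` suffices for the chain rule, even where φ attains an end point. -/
theorem IsCurve.integral_comp (hγ : IsCurve γ) (hX : ContMDiff 𝓘(ℝ, ℂ) 𝓘(ℝ, E3) 1 X)
    {B : M → E3 →L[ℝ] E3} (hB : Continuous B) (hφ : ContDiff ℝ 1 φ)
    (h : ∀ t, φ t ∈ Icc (0 : ℝ) 1) (a b : ℝ) :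
    ∫ t in a..b, B (γ (φ t)) (d X (γ (φ t)) (velocity (γ ∘ φ) t)) =
      ∫ s in φ a..φ b, lineIntegrand B X γ s := by
  have hd : ∀ t, HasDerivAt φ (deriv φ t) t := fun t =>
    (hφ.differentiable (by simp) t).hasDerivAt
  rw [← intervalIntegral.integral_deriv_smul_comp'' (f' := deriv φ) hφ.continuous.continuousOn
    (fun t _ => (hd t).hasDerivWithinAt) (hφ.continuous_deriv le_rfl).continuousOn
    ((hγ.continuousOn_lineIntegrand hX hB).mono (by rintro _ ⟨t, -, rfl⟩; exact h t))]
  refine intervalIntegral.integral_congr fun t _ => ?_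
  have h1 := d_velocity hX (hγ.contMDiff_comp hφ h t)
  have h2 : HasDerivWithinAt (X ∘ γ) (derivWithin (X ∘ γ) (Icc 0 1) (φ t)) (Icc 0 1) (φ t) :=
    ((hγ.contDiffOn hX).differentiableOn (by simp) _ (h t)).hasDerivWithinAt
  have h3 : deriv (X ∘ γ ∘ φ) t = deriv φ t • derivWithin (X ∘ γ) (Icc 0 1) (φ t) :=
    (h2.scomp_hasDerivAt t (hd t) h).deriv
  rw [h3] at h1
  change B (γ (φ t)) (d X ((γ ∘ φ) t) (velocity (γ ∘ φ) t)) = _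
  rw [h1, map_smul]
  rfl

end Reparametrization

theorem smoothTransition_mem (t : ℝ) : Real.smoothTransition t ∈ Icc (0 : ℝ) 1 :=
  ⟨Real.smoothTransition.nonneg t, Real.smoothTransition.le_one t⟩

theorem velocity_congr {γ δ : ℝ → M} {t : ℝ} (h : γ =ᶠ[𝓝 t] δ) : velocity γ t = velocity δ t := by
  unfold velocity
  rw [h.mfderiv_eq]
  rfl

/-- Concatenation of curves. -/
theorem IsCurve.exists_concat (hX : ContMDiff 𝓘(ℝ, ℂ) 𝓘(ℝ, E3) 1 X) {B : M → E3 →L[ℝ] E3}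
    (hB : Continuous B) {γ₁ γ₂ : ℝ → M} (h₁ : IsCurve γ₁) (h₂ : IsCurve γ₂)
    (h : γ₁ 1 = γ₂ 0) : ∃ δ, IsCurve δ ∧ δ 0 = γ₁ 0 ∧ δ 1 = γ₂ 1 ∧
      lineIntegral B X δ = lineIntegral B X γ₁ + lineIntegral B X γ₂ := by
  -- The first curve is run through on [0, 1/3] and the second on [2/3, 1], with a rest at the
  -- common point in between. On the overlap (1/3, 2/3) both formulas are constant and agree, so no
  -- corner arises.
  set φ : ℝ → ℝ := fun t => Real.smoothTransition (3 * t) with hφd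
  set ψ : ℝ → ℝ := fun t => Real.smoothTransition (3 * t - 2) with hψd
  have hφ : ContDiff ℝ 1 φ := Real.smoothTransition.contDiff.comp (contDiff_const.mul contDiff_id)
  have hψ : ContDiff ℝ 1 ψ :=
    Real.smoothTransition.contDiff.comp ((contDiff_const.mul contDiff_id).sub contDiff_const)
  have hφm : ∀ t, φ t ∈ Icc (0 : ℝ) 1 := fun t => smoothTransition_mem _
  have hψm : ∀ t, ψ t ∈ Icc (0 : ℝ) 1 := fun t => smoothTransition_mem _
  have hφ1 : ∀ t, 1 / 3 ≤ t → φ t = 1 := fun t ht =>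
    Real.smoothTransition.one_of_one_le (by linarith)
  have hψ0 : ∀ t, t ≤ 2 / 3 → ψ t = 0 := fun t ht =>
    Real.smoothTransition.zero_of_nonpos (by linarith)
  have hφ0 : φ 0 = 0 := by simp [hφd]
  have hψ1 : ψ 1 = 1 := Real.smoothTransition.one_of_one_le (by norm_num)
  set δ : ℝ → M := fun t => if t < 1 / 2 then γ₁ (φ t) else γ₂ (ψ t) with hδ
  have hδ1 : ∀ t, t < 2 / 3 → δ t = γ₁ (φ t) := fun t ht => by
    simp only [hδ]
    split_ifs with h'
    · rfl
    · rw [hφ1 t (by linarith), hψ0 t ht.le, h]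
  have hδ2 : ∀ t, 1 / 3 < t → δ t = γ₂ (ψ t) := fun t ht => by
    simp only [hδ]
    split_ifs with h'
    · rw [hφ1 t ht.le, hψ0 t (by linarith), h]
    · rfl
  have ev1 : ∀ t, t < 2 / 3 → δ =ᶠ[𝓝 t] γ₁ ∘ φ := fun t ht => by
    filter_upwards [Iio_mem_nhds ht] with s hs using hδ1 s hs
  have ev2 : ∀ t, 1 / 3 < t → δ =ᶠ[𝓝 t] γ₂ ∘ ψ := fun t ht => by
    filter_upwards [Ioi_mem_nhds ht] with s hs using hδ2 s hs
  have hcurve : IsCurve δ := by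
    intro t _
    apply ContMDiffAt.contMDiffWithinAt
    rcases lt_or_ge t (2 / 3) with ht | ht
    · exact (h₁.contMDiff_comp hφ hφm t).congr_of_eventuallyEq (ev1 t ht)
    · exact (h₂.contMDiff_comp hψ hψm t).congr_of_eventuallyEq (ev2 t (by linarith))
  refine ⟨δ, hcurve, ?_, ?_, ?_⟩
  · rw [hδ1 0 (by norm_num), hφ0]
  · rw [hδ2 1 (by norm_num), hψ1]
  have hi := hcurve.intervalIntegrable hX hB
  have hhalf : (1 / 2 : ℝ) ∈ uIcc (0 : ℝ) 1 := by
    rw [uIcc_of_le zero_le_one]; constructor <;> norm_num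
  rw [lineIntegral, ← intervalIntegral.integral_add_adjacent_intervals
    (hi.mono_set (uIcc_subset_uIcc_left hhalf)) (hi.mono_set (uIcc_subset_uIcc_right hhalf)),
    h₁.lineIntegral_eq hX, h₂.lineIntegral_eq hX]
  congr 1
  · have := h₁.integral_comp hX hB hφ hφm 0 (1 / 2)
    rw [hφ0, hφ1 (1 / 2) (by norm_num)] at this
    rw [← this]
    refine intervalIntegral.integral_congr fun t ht => ?_
    rw [uIcc_of_le (by norm_num)] at ht
    have ht' : t < 2 / 3 := by linarith [ht.2]
    rw [velocity_congr (ev1 t ht'), hδ1 t ht']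
  · have := h₂.integral_comp hX hB hψ hψm (1 / 2) 1
    rw [hψ1, hψ0 (1 / 2) (by norm_num)] at this
    rw [← this]
    refine intervalIntegral.integral_congr fun t ht => ?_
    rw [uIcc_of_le (by norm_num)] at ht
    have ht' : 1 / 3 < t := by linarith [ht.1]
    rw [velocity_congr (ev2 t ht'), hδ2 t ht']

theorem IsCurve.exists_reverse (hX : ContMDiff 𝓘(ℝ, ℂ) 𝓘(ℝ, E3) 1 X) {B : M → E3 →L[ℝ] E3}
    (hB : Continuous B) {γ : ℝ → M} (hγ : IsCurve γ) : ∃ δ, IsCurve δ ∧ δ 0 = γ 1 ∧ δ 1 = γ 0 ∧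
      lineIntegral B X δ = -lineIntegral B X γ := by
  -- Unlike 1 - t itself, this stays in [0, 1] for all real t, as `integral_comp` requires.
  set φ : ℝ → ℝ := fun t => Real.smoothTransition (1 - t) with hφd
  have hφ : ContDiff ℝ 1 φ := Real.smoothTransition.contDiff.comp (contDiff_const.sub contDiff_id)
  have hφm : ∀ t, φ t ∈ Icc (0 : ℝ) 1 := fun t => smoothTransition_mem _
  refine ⟨γ ∘ φ, (hγ.contMDiff_comp hφ hφm).contMDiffOn, by simp [hφd], by simp [hφd], ?_⟩
  have := hγ.integral_comp hX hB hφ hφm 0 1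
  rw [hγ.lineIntegral_eq hX, ← intervalIntegral.integral_symm]
  simpa [hφd, lineIntegral] using this

/-! ### Primitives of one-forms -/

section Manifold

variable [IsManifold 𝓘(ℂ) ω M]

/-- Curves that are straight in a chart. -/
theorem isCurve_segment {e : OpenPartialHomeomorph M ℂ} (he : e ∈ atlas ℂ M) {z h : ℂ}
    (hz : ∀ t ∈ Icc (0 : ℝ) 1, z + t • h ∈ e.target) :
    IsCurve fun t : ℝ => e.symm (z + t • h) := by
  have := isManifold_real M 1
  have h1 : ContDiff ℝ 1 fun t : ℝ => z + t • h := by fun_prop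
  exact (contMDiffOn_symm_of_mem_maximalAtlas (I := 𝓘(ℝ, ℂ)) (n := 1)
    (IsManifold.subset_maximalAtlas he)).comp h1.contMDiff.contMDiffOn hz

theorem lineIntegral_segment (hX : ContMDiff 𝓘(ℝ, ℂ) 𝓘(ℝ, E3) 1 X) (B : M → E3 →L[ℝ] E3)
    {e : OpenPartialHomeomorph M ℂ} (he : e ∈ atlas ℂ M) {z h : ℂ}
    (hz : ∀ t ∈ Icc (0 : ℝ) 1, z + t • h ∈ e.target) :
    lineIntegral B X (fun t : ℝ => e.symm (z + t • h)) =
      ∫ t in (0 : ℝ)..1, B (e.symm (z + t • h)) (fderiv ℝ (X ∘ e.symm) (z + t • h) h) := by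
  have hγ := isCurve_segment he hz
  apply intervalIntegral.integral_congr_ae_restrict
  rw [uIoc_of_le zero_le_one, ← restrict_Ioo_eq_restrict_Ioc]
  filter_upwards [ae_restrict_mem measurableSet_Ioo] with t ht
  rw [d_velocity hX (hγ.contMDiffAt ht)]
  congr 1
  have h1 : HasDerivAt (fun t : ℝ => z + t • h) h t := by
    simpa using ((hasDerivAt_id t).smul_const h).const_add z
  have hmem := hz t (Ioo_subset_Icc_self ht)
  have h2 : DifferentiableAt ℝ (X ∘ e.symm) (z + t • h) :=
    ((contDiffOn_comp_symm hX he).differentiableOn (by simp) _ hmem).differentiableAt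
      (e.open_target.mem_nhds hmem)
  exact (h2.hasFDerivAt.comp_hasDerivAt t h1).deriv

/-- Being joined by a curve is symmetric and transitive, and holds near each point by chart
segments, so connectedness makes it universal. -/
theorem exists_isCurve [ConnectedSpace M] (hX : ContMDiff 𝓘(ℝ, ℂ) 𝓘(ℝ, E3) 1 X) (p q : M) :
    ∃ γ, IsCurve γ ∧ γ 0 = p ∧ γ 1 = q := by
  have hB : Continuous fun _ : M => ContinuousLinearMap.id ℝ E3 := continuous_const
  have : Std.Symm fun p q : M => ∃ γ, IsCurve γ ∧ γ 0 = p ∧ γ 1 = q := by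
    constructor
    rintro _ _ ⟨γ, hγ, rfl, rfl⟩
    obtain ⟨δ, h3, h4, h5, -⟩ := hγ.exists_reverse hX hB
    exact ⟨δ, h3, h4, h5⟩
  refine PreconnectedSpace.induction₂ (fun p q : M => ∃ γ, IsCurve γ ∧ γ 0 = p ∧ γ 1 = q)
    (fun p => ?_) ⟨?_⟩ p q
  · set e := chartAt ℂ p
    have he : e ∈ atlas ℂ M := chart_mem_atlas ℂ p
    have hp : p ∈ e.source := mem_chart_source ℂ p
    obtain ⟨ε, hε, hball⟩ := Metric.isOpen_iff.1 e.open_target _ (e.map_source hp)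
    filter_upwards [e.open_source.mem_nhds hp,
      (e.continuousAt hp).preimage_mem_nhds (Metric.ball_mem_nhds _ hε)] with q hq hq'
    refine ⟨fun t => e.symm (e p + t • (e q - e p)), isCurve_segment he fun t ht => hball ?_, ?_, ?_⟩
    · exact (convex_ball (e p) ε).add_smul_sub_mem (Metric.mem_ball_self hε) hq' ht
    · simp [e.left_inv hp]
    · simp [e.left_inv hq]
  · rintro _ _ _ ⟨γ₁, h₁, rfl, h⟩ ⟨γ₂, h₂, rfl, rfl⟩
    obtain ⟨δ, h3, h4, h5, -⟩ := h₁.exists_concat hX hB h₂ h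
    exact ⟨δ, h3, h4, h5⟩

/-- A one-form whose integrals along closed curves vanish has a primitive. -/
theorem exists_primitive [ConnectedSpace M] (hX : ContMDiff 𝓘(ℝ, ℂ) 𝓘(ℝ, E3) 1 X)
    {B : M → E3 →L[ℝ] E3} (hB : Continuous B)
    (h : ∀ γ, IsCurve γ → γ 0 = γ 1 → lineIntegral B X γ = 0) :
    ∃ Y : M → E3, ∀ γ, IsCurve γ → Y (γ 1) - Y (γ 0) = lineIntegral B X γ := by
  obtain ⟨p⟩ : Nonempty M := inferInstance
  choose c hc hc0 hc1 using exists_isCurve hX p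
  refine ⟨fun q => lineIntegral B X (c q), fun γ hγ => ?_⟩
  -- The closed curve runs from the base point to `γ 0`, along γ, and back from `γ 1`.
  obtain ⟨α, hα, hα0, hα1, hαi⟩ := (hc (γ 0)).exists_concat hX hB hγ (hc1 _)
  obtain ⟨β, hβ, hβ0, hβ1, hβi⟩ := (hc (γ 1)).exists_reverse hX hB
  obtain ⟨δ, hδ, hδ0, hδ1, hδi⟩ := hα.exists_concat hX hB hβ (by rw [hα1, hβ0, hc1])
  have := h δ hδ (by rw [hδ0, hδ1, hα0, hβ1, hc0, hc0])
  rw [hδi, hαi, hβi] at this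
  rw [sub_eq_iff_eq_add, ← sub_eq_zero, ← neg_eq_zero, ← this]
  abel

/-- The increment of Y along a short chart segment is the mean over that segment of a form
continuous in the chart, so it differs from the form at z by o(|h|). No regularity of Y is
presupposed. -/
theorem hasFDerivAt_primitive (hX : ContMDiff 𝓘(ℝ, ℂ) 𝓘(ℝ, E3) 1 X) {B : M → E3 →L[ℝ] E3}
    (hB : Continuous B) {Y : M → E3}
    (hY : ∀ γ, IsCurve γ → Y (γ 1) - Y (γ 0) = lineIntegral B X γ)
    {e : OpenPartialHomeomorph M ℂ} (he : e ∈ atlas ℂ M) {z : ℂ} (hz : z ∈ e.target) :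
    HasFDerivAt (Y ∘ e.symm) ((B (e.symm z)).comp (fderiv ℝ (X ∘ e.symm) z)) z := by
  set W : ℂ → ℂ →L[ℝ] E3 := fun z => (B (e.symm z)).comp (fderiv ℝ (X ∘ e.symm) z) with hW
  have hWc : ContinuousOn W e.target :=
    (hB.comp_continuousOn e.continuousOn_symm).clm_comp
      ((contDiffOn_comp_symm hX he).continuousOn_fderiv_of_isOpen e.open_target le_rfl)
  rw [hasFDerivAt_iff_isLittleO_nhds_zero, Asymptotics.isLittleO_iff]
  intro ε hε
  obtain ⟨δ, hδ, hball⟩ := Metric.isOpen_iff.1 e.open_target z hz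
  obtain ⟨δ', hδ', hWε⟩ := Metric.continuousAt_iff.1
    (hWc.continuousAt (e.open_target.mem_nhds hz)) ε hε
  filter_upwards [Metric.ball_mem_nhds (0 : ℂ) (lt_min hδ hδ')] with h hh
  rw [mem_ball_zero_iff, lt_min_iff] at hh
  have hnorm : ∀ t ∈ Icc (0 : ℝ) 1, ‖t • h‖ ≤ ‖h‖ := fun t ht => by
    rw [norm_smul, Real.norm_of_nonneg ht.1]
    exact mul_le_of_le_one_left (norm_nonneg _) ht.2
  have hseg : ∀ t ∈ Icc (0 : ℝ) 1, z + t • h ∈ e.target := fun t ht =>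
    hball (by simpa using (hnorm t ht).trans_lt hh.1)
  have h1 := hY _ (isCurve_segment he hseg)
  rw [lineIntegral_segment hX B he hseg] at h1
  have hint : IntervalIntegrable (fun t : ℝ => W (z + t • h) h) volume 0 1 := by
    apply ContinuousOn.intervalIntegrable
    rw [uIcc_of_le zero_le_one]
    exact (hWc.comp (by fun_prop) hseg).clm_apply continuousOn_const
  have h2 : (Y ∘ e.symm) (z + h) - (Y ∘ e.symm) z - W z h =
      ∫ t in (0 : ℝ)..1, (W (z + t • h) h - W z h) := by
    rw [intervalIntegral.integral_sub hint intervalIntegrable_const]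
    simp only [one_smul, zero_smul, add_zero] at h1
    simp only [Function.comp_apply, h1, intervalIntegral.integral_const, sub_zero, one_smul]
    rfl
  rw [h2]
  refine (intervalIntegral.norm_integral_le_of_norm_le_const (C := ε * ‖h‖) fun t ht => ?_).trans
    (by simp)
  rw [uIoc_of_le zero_le_one] at ht
  have ht' := Ioc_subset_Icc_self ht
  rw [← sub_apply]
  refine (ContinuousLinearMap.le_opNorm _ _).trans
    (mul_le_mul_of_nonneg_right ?_ (norm_nonneg _))
  rw [← dist_eq_norm]
  exact (hWε (by simpa [dist_eq_norm] using (hnorm t ht').trans_lt hh.2)).le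

theorem d_primitive (hX : ContMDiff 𝓘(ℝ, ℂ) 𝓘(ℝ, E3) 1 X) {B : M → E3 →L[ℝ] E3}
    (hB : Continuous B) {Y : M → E3}
    (hY : ∀ γ, IsCurve γ → Y (γ 1) - Y (γ 0) = lineIntegral B X γ) (p : M) :
    d Y p = (B p).comp (d X p) := by
  set e := chartAt ℂ p
  have he : e ∈ atlas ℂ M := chart_mem_atlas ℂ p
  have hp : p ∈ e.source := mem_chart_source ℂ p
  have h1 := hasFDerivAt_primitive hX hB hY he (e.map_source hp)
  have hc : ContinuousAt Y p := by
    refine ((ContinuousAt.comp (g := Y ∘ e.symm) (f := e) h1.continuousAt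
      (e.continuousAt hp))).congr ?_
    filter_upwards [e.open_source.mem_nhds hp] with q hq
    simp [e.left_inv hq]
  rw [e.left_inv hp, ← d_eq_fderiv ((hX p).mdifferentiableAt (by simp))] at h1
  exact (d_of_hasFDerivAt hc h1).mfderiv

end Manifold

variable {Y : M → E3}

/-! ### Completeness -/

theorem lintegral_eq_top_of_le_mul {α : Type*} [MeasurableSpace α] {μ : Measure α}
    {f₁ f₂ : α → ENNReal} {C : ENNReal} (hC : C ≠ ⊤) (h : ∀ x, f₁ x ≤ C * f₂ x)
    (h₁ : ∫⁻ x, f₁ x ∂μ = ⊤) : ∫⁻ x, f₂ x ∂μ = ⊤ := by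
  by_contra h₂
  have h3 := lintegral_mono (μ := μ) h
  rw [h₁, lintegral_const_mul' _ _ hC] at h3
  exact ENNReal.mul_ne_top hC h₂ (top_le_iff.1 h3)

theorem enorm_le_ofReal_mul_enorm {E F : Type*} [SeminormedAddCommGroup E]
    [SeminormedAddCommGroup F] {a : E} {b : F} {C : ℝ} (hC : 0 ≤ C) (h : ‖a‖ ≤ C * ‖b‖) :
    ‖a‖ₑ ≤ ENNReal.ofReal C * ‖b‖ₑ := by
  rw [← ofReal_norm, ← ofReal_norm, ← ENNReal.ofReal_mul hC]
  exact ENNReal.ofReal_le_ofReal h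

theorem isCompleteMap_iff (hX : ∀ p, IsConformalMap (d X p)) {r : ℝ} (hr : 0 < r) :
    IsCompleteMap X ↔ IsCompleteDeformation X r := by
  have hnorm : ∀ p v, ‖rePhi X r p v‖ = factor r (gaussMap X p) * ‖d X p v‖ := fun p v => by
    rw [rePhi_eq_deform (hX p), norm_deform hr (norm_gaussMap (hX p)) (inner_gaussMap_d (hX p) v)]
  have hmin : 0 < min r r⁻¹ := lt_min hr (inv_pos.2 hr)
  refine forall₂_congr fun γ _ => ⟨?_, ?_⟩
  · refine lintegral_eq_top_of_le_mul (C := ENNReal.ofReal (min r r⁻¹)⁻¹) ENNReal.ofReal_ne_top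
      fun t => enorm_le_ofReal_mul_enorm (by positivity) ?_
    rw [hnorm, ← div_eq_inv_mul, le_div_iff₀ hmin, mul_comm]
    exact mul_le_mul_of_nonneg_right (factor_lower (norm_gaussMap (hX _))) (norm_nonneg _)
  · refine lintegral_eq_top_of_le_mul (C := ENNReal.ofReal (max r r⁻¹)) ENNReal.ofReal_ne_top
      fun t => enorm_le_ofReal_mul_enorm (by positivity) ?_
    rw [hnorm]
    exact mul_le_mul_of_nonneg_right (factor_upper (norm_gaussMap (hX _))) (norm_nonneg _)

/-! ### Total curvature -/

/-- Both determinants are minors of inner products, so the Cauchy–Binet identity applies; only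
vector products then need to be followed through the deformation. -/
theorem gaussCurvature_eq (X : M → E3) (p : M) : gaussCurvature X p =
    inner ℝ (cross (d (gaussMap X) p 1) (d (gaussMap X) p I)) (cross (d X p 1) (d X p I)) /
      ‖cross (d X p 1) (d X p I)‖ ^ 2 := by
  rw [gaussCurvature, Matrix.det_fin_two, Matrix.det_fin_two, inner_cross_cross,
    ← real_inner_self_eq_norm_sq, inner_cross_cross]
  simp [secondForm, firstForm, basisVec]

/-- The linear part of `moebiusNum r`. -/
def moebiusLin (r : ℝ) : E3 →L[ℝ] E3 :=
  LinearMap.toContinuousLinearMap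
    { toFun := fun a => !₂[a 0, a 1, (r + r⁻¹) / 2 * a 2]
      map_add' := fun a b => by apply ext_three <;> simp; ring
      map_smul' := fun t a => by apply ext_three <;> simp; ring }

theorem moebiusLin_apply_zero (r : ℝ) (a : E3) : moebiusLin r a 0 = a 0 := rfl

theorem moebiusLin_apply_one (r : ℝ) (a : E3) : moebiusLin r a 1 = a 1 := rfl

theorem moebiusLin_apply_two (r : ℝ) (a : E3) : moebiusLin r a 2 = (r + r⁻¹) / 2 * a 2 := rfl

/-- The action of the Möbius transformation `z ↦ r z` on the unit sphere. -/
def moebius (r : ℝ) (n : E3) : E3 := (factor r n)⁻¹ • moebiusNum r n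

/-- The functional β, the derivative of the inverse factor, need not be known: its term points along
the new normal and drops out of the curvature. -/
theorem exists_hasFDerivAt_moebius {r : ℝ} (hr : 0 < r) {n : E3} (hn : ‖n‖ = 1) :
    ∃ β : E3 →L[ℝ] ℝ, HasFDerivAt (moebius r)
      ((factor r n)⁻¹ • moebiusLin r + β.smulRight (moebiusNum r n)) n := by
  have h1 : HasFDerivAt (moebiusNum r) (moebiusLin r) n := by
    have : moebiusNum r = fun n => moebiusLin r n + !₂[0, 0, (r - r⁻¹) / 2] := by
      funext n
      apply ext_three <;> simp [moebiusNum, moebiusLin, add_comm]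
    rw [this]
    exact (moebiusLin r).hasFDerivAt.add_const _
  have h2 : DifferentiableAt ℝ (fun n => (factor r n)⁻¹) n := by
    refine DifferentiableAt.inv ?_ (factor_pos hr hn).ne'
    unfold factor
    fun_prop
  exact ⟨_, h2.hasFDerivAt.smul h1⟩

/-- The terms in x and y vanish in a triple product with `moebiusNum r n`. The rest reduces to c + s
· n 2, the factor, since a × b is a multiple of n. -/
theorem inner_cross_moebius {r : ℝ} (hr : 0 < r) {n a b : E3} (hn : ‖n‖ = 1)
    (ha : inner ℝ n a = 0) (hb : inner ℝ n b = 0) {k x y : ℝ} :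
    inner ℝ (cross (k • moebiusLin r a + x • moebiusNum r n)
      (k • moebiusLin r b + y • moebiusNum r n)) (moebiusNum r n) =
      k ^ 2 * factor r n * inner ℝ (cross a b) n := by
  have hn' : inner ℝ n n = 1 := by rw [real_inner_self_eq_norm_sq, hn]; norm_num
  have hab := cross_eq_smul hn ha hb
  set t := inner ℝ (cross a b) n
  have h0 : a 1 * b 2 - a 2 * b 1 = t * n 0 := by rw [← cross_apply_zero, hab]; rfl
  have h1 : a 2 * b 0 - a 0 * b 2 = t * n 1 := by rw [← cross_apply_one, hab]; rfl
  have h2 : a 0 * b 1 - a 1 * b 0 = t * n 2 := by rw [← cross_apply_two, hab]; rfl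
  have hr' := mul_inv_cancel₀ hr.ne'
  simp only [inner_eq, cross_apply_zero, cross_apply_one, cross_apply_two, PiLp.add_apply,
    PiLp.smul_apply, smul_eq_mul, moebiusLin_apply_zero, moebiusLin_apply_one,
    moebiusLin_apply_two, moebiusNum_apply_zero, moebiusNum_apply_one, moebiusNum_apply_two,
    factor] at hn' ⊢
  linear_combination k ^ 2 * ((r + r⁻¹) / 2 * n 0 * h0 + (r + r⁻¹) / 2 * n 1 * h1 +
    ((r - r⁻¹) / 2 + (r + r⁻¹) / 2 * n 2) * h2) + k ^ 2 * t * (r + r⁻¹) / 2 * hn'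

theorem inner_gaussMap_d_gaussMap (hX : ∀ p, IsConformalMap (d X p)) {p : M}
    (hN : MDifferentiableAt 𝓘(ℝ, ℂ) 𝓘(ℝ, E3) (gaussMap X) p) (v : ℂ) :
    inner ℝ (gaussMap X p) (d (gaussMap X) p v) = 0 := by
  have h1 : HasFDerivAt (fun x : E3 => ‖x‖ ^ 2) (2 • innerSL ℝ (gaussMap X p)) (gaussMap X p) :=
    (hasStrictFDerivAt_norm_sq _).hasFDerivAt
  have h2 := (h1.hasMFDerivAt).comp p hN.hasMFDerivAt
  have h3 : (fun x : E3 => ‖x‖ ^ 2) ∘ gaussMap X = fun _ => 1 := by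
    funext q
    simp [norm_gaussMap (hX q)]
  rw [h3] at h2
  have h4 := hasMFDerivAt_unique h2 (hasMFDerivAt_const (1 : ℝ) p)
  have h5 := congrArg (fun L : ℂ →L[ℝ] ℝ => L v) h4
  have h6 : (2 • innerSL ℝ (gaussMap X p)) (d (gaussMap X) p v) = 0 := h5
  simpa using h6

theorem cross_d_eq_smul_gaussMap {p : M} (h : IsConformalMap (d X p)) :
    cross (d X p 1) (d X p I) = ‖cross (d X p 1) (d X p I)‖ • gaussMap X p := by
  rw [gaussMap, smul_smul, mul_inv_cancel₀ (norm_ne_zero_iff.2 (cross_d_ne_zero h)), one_smul]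

theorem cross_d_deformed {r : ℝ} (hX : ∀ p, IsConformalMap (d X p))
    (hd : ∀ p, d Y p = (deform r (gaussMap X p)).comp (d X p)) (p : M) :
    cross (d Y p 1) (d Y p I) =
    (factor r (gaussMap X p) * ‖cross (d X p 1) (d X p I)‖) • moebiusNum r (gaussMap X p) := by
  rw [hd p]
  exact cross_deform (norm_gaussMap (hX p)) (cross_d_eq_smul_gaussMap (hX p))

theorem norm_cross_d_deformed {r : ℝ} (hr : 0 < r) (hX : ∀ p, IsConformalMap (d X p))
    (hd : ∀ p, d Y p = (deform r (gaussMap X p)).comp (d X p)) (p : M) :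
    ‖cross (d Y p 1) (d Y p I)‖ =
    factor r (gaussMap X p) ^ 2 * ‖cross (d X p 1) (d X p I)‖ := by
  have hn := norm_gaussMap (hX p)
  have hk := factor_pos hr hn
  rw [cross_d_deformed hX hd, norm_smul, norm_moebiusNum hr hn, Real.norm_of_nonneg (by positivity)]
  ring

theorem gaussMap_deformed {r : ℝ} (hr : 0 < r) (hX : ∀ p, IsConformalMap (d X p))
    (hd : ∀ p, d Y p = (deform r (gaussMap X p)).comp (d X p)) :
    gaussMap Y = moebius r ∘ gaussMap X := by
  funext p
  have hk := factor_pos hr (norm_gaussMap (hX p))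
  have ht := norm_ne_zero_iff.2 (cross_d_ne_zero (hX p))
  rw [gaussMap, norm_cross_d_deformed hr hX hd, cross_d_deformed hX hd, smul_smul]
  simp only [Function.comp_apply, moebius]
  congr 1
  field_simp

/-- In `gaussCurvature_eq` the numerator is unchanged, the product for the Gauss map contributing
k⁻² and the one for the immersion k²; the denominator grows by k⁴. -/
theorem gaussCurvature_deformed {r : ℝ} (hr : 0 < r) (hX : ∀ p, IsConformalMap (d X p))
    (hd : ∀ p, d Y p = (deform r (gaussMap X p)).comp (d X p)) {p : M}
    (hN : MDifferentiableAt 𝓘(ℝ, ℂ) 𝓘(ℝ, E3) (gaussMap X) p) :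
    gaussCurvature Y p = gaussCurvature X p / factor r (gaussMap X p) ^ 4 := by
  have hn := norm_gaussMap (hX p)
  have hk := factor_pos hr hn
  obtain ⟨β, hβ⟩ := exists_hasFDerivAt_moebius hr hn
  have hdN : ∀ v, d (gaussMap Y) p v = (factor r (gaussMap X p))⁻¹ •
      moebiusLin r (d (gaussMap X) p v) + β (d (gaussMap X) p v) • moebiusNum r (gaussMap X p) := by
    intro v
    rw [gaussMap_deformed hr hX hd]
    have := ((hβ.hasMFDerivAt).comp p hN.hasMFDerivAt).mfderiv
    rw [d, this]
    rfl
  have ht := norm_ne_zero_iff.2 (cross_d_ne_zero (hX p))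
  rw [gaussCurvature_eq Y, gaussCurvature_eq X, norm_cross_d_deformed hr hX hd,
    cross_d_deformed hX hd, hdN, hdN, inner_smul_right,
    inner_cross_moebius hr hn (inner_gaussMap_d_gaussMap hX hN _)
      (inner_gaussMap_d_gaussMap hX hN _)]
  conv_rhs => rw [cross_d_eq_smul_gaussMap (hX p), inner_smul_right, norm_smul, hn]
  rw [Real.norm_of_nonneg (norm_nonneg _)]
  field_simp

/-! ### Area -/

theorem measurable_enorm_chartNormal {M : Type*} [TopologicalSpace M] (X : M → E3)
    (e : OpenPartialHomeomorph M ℂ) :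
    Measurable fun z => ‖chartNormal X e z‖ₑ := by
  have h := fun v : ℂ => measurable_fderiv_apply_const ℝ (X ∘ e.symm) v
  exact (continuous_cross.measurable.comp ((h 1).prodMk (h I))).enorm

/-- Only an inequality is claimed, so it can be checked on each chart measure below the supremum,
without any gluing on overlaps. The opposite estimate comes from exchanging X and Y and inverting
the density. -/
theorem area_le_withDensity [MeasurableSpace M] [BorelSpace M] {ρ : M → ENNReal} (hρ : Measurable ρ)
    (h : ∀ e ∈ atlas ℂ M, ∀ z ∈ e.target,
      ‖chartNormal Y e z‖ₑ = ‖chartNormal X e z‖ₑ * ρ (e.symm z)) :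
    area Y ≤ (area X).withDensity ρ := by
  refine iSup₂_le fun e he => ?_
  have hT := e.open_target.measurableSet
  have hm : ∀ Z : M → E3, Measure.map e.symm
      ((volume.withDensity fun z => ‖chartNormal Z e z‖ₑ).restrict e.target) ≤ area Z :=
    fun Z => le_iSup₂ (f := fun (e : OpenPartialHomeomorph M ℂ) (_ : e ∈ atlas ℂ M) =>
      Measure.map e.symm
        ((volume.withDensity fun z => ‖chartNormal Z e z‖ₑ).restrict e.target)) e he
  change Measure.map e.symm
    ((volume.withDensity fun z => ‖chartNormal Y e z‖ₑ).restrict e.target) ≤ _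
  have hmX := hm X
  rw [restrict_withDensity hT] at hmX ⊢
  set μ := (volume : Measure ℂ).restrict e.target
  -- Off `e.target` the inverse chart is arbitrary, hence only almost everywhere measurability for
  -- the restricted measure.
  have hem : AEMeasurable e.symm μ := e.continuousOn_symm.aemeasurable hT
  have hJX := measurable_enorm_chartNormal X e
  have e1 : μ.withDensity (fun z => ‖chartNormal Y e z‖ₑ) =
      (μ.withDensity fun z => ‖chartNormal X e z‖ₑ).withDensity (ρ ∘ e.symm) := by
    rw [← withDensity_mul₀ hJX.aemeasurable (hρ.comp_aemeasurable hem)]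
    apply withDensity_congr_ae
    filter_upwards [ae_restrict_mem hT] with z hz
    exact h e he z hz
  rw [e1]
  set ν := μ.withDensity fun z => ‖chartNormal X e z‖ₑ
  have hν : AEMeasurable e.symm ν := hem.mono_ac (withDensity_absolutelyContinuous _ _)
  refine Measure.le_iff.2 fun s hs => ?_
  rw [Measure.map_apply_of_aemeasurable (hν.mono_ac (withDensity_absolutelyContinuous _ _)) hs,
    withDensity_apply _ hs]
  calc ν.withDensity (ρ ∘ e.symm) (e.symm ⁻¹' s)
      = ∫⁻ z in e.symm ⁻¹' s, ρ (e.symm z) ∂ν :=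
        withDensity_apply₀ _ (hν.nullMeasurableSet_preimage hs)
    _ = ∫⁻ q in s, ρ q ∂(Measure.map e.symm ν) := by
        rw [Measure.restrict_map_of_aemeasurable hν hs, lintegral_map' hρ.aemeasurable]
        exact hν.mono_measure Measure.restrict_le_self
    _ ≤ ∫⁻ q in s, ρ q ∂(area X) := lintegral_mono' (Measure.restrict_mono subset_rfl hmX) le_rfl

theorem lintegral_lt_top_of_le_withDensity {α : Type*} [MeasurableSpace α] {μ ν : Measure α}
    {ρ f₁ f₂ : α → ENNReal} {C : ENNReal}
    (hμ : μ ≤ ν.withDensity ρ) (hρ : Measurable ρ) (hρt : ∀ q, ρ q < ⊤) (hC : C ≠ ⊤)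
    (h : ∀ q, ρ q * f₁ q ≤ C * f₂ q) (h₂ : ∫⁻ q, f₂ q ∂ν < ⊤) : ∫⁻ q, f₁ q ∂μ < ⊤ :=
  calc ∫⁻ q, f₁ q ∂μ ≤ ∫⁻ q, f₁ q ∂(ν.withDensity ρ) := lintegral_mono' hμ le_rfl
    _ = ∫⁻ q, ρ q * f₁ q ∂ν :=
        -- Finiteness of ρ makes this valid for any integrand, so measurability of the curvature is
        -- never needed.
        lintegral_withDensity_eq_lintegral_mul_non_measurable _ hρ (ae_of_all _ hρt) _
    _ ≤ ∫⁻ q, C * f₂ q ∂ν := lintegral_mono h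
    _ = C * ∫⁻ q, f₂ q ∂ν := lintegral_const_mul' _ _ hC
    _ < ⊤ := ENNReal.mul_lt_top hC.lt_top h₂

theorem isDeformation_iff (hX : ∀ p, IsConformalMap (d X p)) (r : ℝ) :
    IsDeformation X r Y ↔ ∀ γ, IsCurve γ →
      Y (γ 1) - Y (γ 0) = lineIntegral (fun p => deform r (gaussMap X p)) X γ := by
  refine forall₂_congr fun γ _ => ?_
  simp only [lineIntegral, rePhi_eq_deform (hX _)]

theorem HasFiniteTotalCurvature.iff_deformation [IsManifold 𝓘(ℂ) ω M] [MeasurableSpace M]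
    [BorelSpace M] (hX2 : ContMDiff 𝓘(ℝ, ℂ) 𝓘(ℝ, E3) 2 X) (hX : ∀ p, IsConformalMap (d X p))
    {r : ℝ} (hr : 0 < r) (hY : IsDeformation X r Y) :
    HasFiniteTotalCurvature X ↔ HasFiniteTotalCurvature Y := by
  have hX1 : ContMDiff 𝓘(ℝ, ℂ) 𝓘(ℝ, E3) 1 X := hX2.of_le (by norm_num)
  have hN := contMDiff_gaussMap hX2 hX
  have hB : Continuous fun p => deform r (gaussMap X p) :=
    (continuous_deform r).comp hN.continuous
  rw [isDeformation_iff hX] at hY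
  have hd : ∀ p, d Y p = (deform r (gaussMap X p)).comp (d X p) :=
    d_primitive hX1 hB hY
  have hk : ∀ p, 0 < factor r (gaussMap X p) := fun p => factor_pos hr (norm_gaussMap (hX p))
  have hkc : Continuous fun p => factor r (gaussMap X p) :=
    (continuous_factor r).comp hN.continuous
  have hK : ∀ p, gaussCurvature Y p = gaussCurvature X p / factor r (gaussMap X p) ^ 4 :=
    fun p => gaussCurvature_deformed hr hX hd ((hN p).mdifferentiableAt (by simp))
  have hJ : ∀ e ∈ atlas ℂ M, ∀ z ∈ e.target, ‖chartNormal Y e z‖ =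
      ‖chartNormal X e z‖ * factor r (gaussMap X (e.symm z)) ^ 2 := by
    intro e he z hz
    have hq := e.map_target hz
    have h1 := gaussMap_eq_chart he hq hX1
    have h2 := chartNormal_ne_zero he hq hX1 (hX _)
    rw [e.right_inv hz] at h1 h2
    have hn := norm_gaussMap (hX (e.symm z))
    have hc : chartNormal X e z = ‖chartNormal X e z‖ • gaussMap X (e.symm z) := by
      rw [h1, smul_smul, mul_inv_cancel₀ (norm_ne_zero_iff.2 h2), one_smul]
    rw [chartNormal, (hasFDerivAt_primitive hX1 hB hY he hz).fderiv]
    have hc' := cross_deform (r := r) hn hc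
    refine (congrArg norm hc').trans ?_
    rw [norm_smul, norm_moebiusNum hr hn,
      Real.norm_of_nonneg (mul_nonneg (hk _).le (norm_nonneg _))]
    ring
  have hmin : 0 < min r r⁻¹ := lt_min hr (inv_pos.2 hr)
  constructor
  · refine lintegral_lt_top_of_le_withDensity
      (ρ := fun p => ENNReal.ofReal (factor r (gaussMap X p) ^ 2))
      (C := ENNReal.ofReal ((min r r⁻¹) ^ 2)⁻¹) (area_le_withDensity ?_ ?_) ?_
      (fun _ => ENNReal.ofReal_lt_top) ENNReal.ofReal_ne_top fun p => ?_
    · exact (hkc.pow 2).measurable.ennreal_ofReal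
    · intro e he z hz
      rw [← ofReal_norm, ← ofReal_norm, ← ENNReal.ofReal_mul (norm_nonneg _), hJ e he z hz]
    · exact (hkc.pow 2).measurable.ennreal_ofReal
    · have hk' := hk p
      rw [← ofReal_norm, ← ofReal_norm, ← ENNReal.ofReal_mul (by positivity),
        ← ENNReal.ofReal_mul (by positivity), hK, norm_div, norm_pow, Real.norm_of_nonneg hk'.le]
      apply ENNReal.ofReal_le_ofReal
      have h1 := factor_lower (r := r) (norm_gaussMap (hX p))
      calc factor r (gaussMap X p) ^ 2 * (‖gaussCurvature X p‖ / factor r (gaussMap X p) ^ 4)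
          = (factor r (gaussMap X p) ^ 2)⁻¹ * ‖gaussCurvature X p‖ := by field_simp
        _ ≤ _ := by gcongr
  -- Now X is compared with Y: the density is k⁻², and k⁻² |K| = k² |K_r| is bounded through the
  -- upper bound for k.
  · refine lintegral_lt_top_of_le_withDensity
      (ρ := fun p => ENNReal.ofReal (factor r (gaussMap X p) ^ 2)⁻¹)
      (C := ENNReal.ofReal ((max r r⁻¹) ^ 2)) (area_le_withDensity ?_ ?_) ?_
      (fun _ => ENNReal.ofReal_lt_top) ENNReal.ofReal_ne_top fun p => ?_
    · exact ((hkc.pow 2).measurable.inv).ennreal_ofReal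
    · intro e he z hz
      have hk' := hk (e.symm z)
      rw [← ofReal_norm, ← ofReal_norm, ← ENNReal.ofReal_mul (norm_nonneg _), hJ e he z hz,
        mul_assoc, mul_inv_cancel₀ (by positivity), mul_one]
    · exact ((hkc.pow 2).measurable.inv).ennreal_ofReal
    · have hk' := hk p
      rw [← ofReal_norm, ← ofReal_norm, ← ENNReal.ofReal_mul (by positivity),
        ← ENNReal.ofReal_mul (by positivity), hK, norm_div, norm_pow, Real.norm_of_nonneg hk'.le]
      apply ENNReal.ofReal_le_ofReal
      have h1 := factor_upper (r := r) (norm_gaussMap (hX p))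
      calc (factor r (gaussMap X p) ^ 2)⁻¹ * ‖gaussCurvature X p‖
          = factor r (gaussMap X p) ^ 2 *
            (‖gaussCurvature X p‖ / factor r (gaussMap X p) ^ 4) := by field_simp
        _ ≤ _ := by gcongr

/-! ### Flux -/

/-- The vector product with a fixed vector as a continuous linear map. -/
def crossCLM (n : E3) : E3 →L[ℝ] E3 :=
  LinearMap.toContinuousLinearMap
    { toFun := cross n
      map_add' := cross_add_right n
      map_smul' := fun t a => cross_smul_right t n a }

theorem continuous_crossCLM : Continuous crossCLM := by
  rw [continuous_clm_apply]
  intro a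
  exact continuous_cross.comp (continuous_id.prodMk continuous_const)

theorem intervalIntegral_apply {f : ℝ → E3} {a b : ℝ} (hf : IntervalIntegrable f volume a b)
    (k : Fin 3) : (∫ t in a..b, f t) k = ∫ t in a..b, f t k :=
  ((EuclideanSpace.proj (𝕜 := ℝ) k).intervalIntegral_comp_comm hf).symm

theorem intervalIntegrable_apply {f : ℝ → E3} {a b : ℝ}
    (hf : IntervalIntegrable f volume a b) (k : Fin 3) :
    IntervalIntegrable (fun t => f t k) volume a b :=
  ⟨(EuclideanSpace.proj (𝕜 := ℝ) k).integrable_comp hf.1,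
    (EuclideanSpace.proj (𝕜 := ℝ) k).integrable_comp hf.2⟩

section Flux

variable [IsManifold 𝓘(ℂ) ω M]

/-- The period of the deformation along a closed curve is determined by the horizontal flux. -/
theorem lineIntegral_deform_of_closed (hX2 : ContMDiff 𝓘(ℝ, ℂ) 𝓘(ℝ, E3) 2 X)
    (hX : ∀ p, IsConformalMap (d X p)) (r : ℝ) {γ : ℝ → M} (hγ : IsCurve γ) (hc : γ 0 = γ 1) :
    lineIntegral (fun p => deform r (gaussMap X p)) X γ =
      !₂[(r - r⁻¹) / 2 * flux X γ 1, -((r - r⁻¹) / 2 * flux X γ 0), 0] := by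
  have hX1 : ContMDiff 𝓘(ℝ, ℂ) 𝓘(ℝ, E3) 1 X := hX2.of_le (by norm_num)
  have hN := (contMDiff_gaussMap hX2 hX).continuous
  have ia : IntervalIntegrable (fun t => d X (γ t) (velocity γ t)) volume 0 1 :=
    hγ.intervalIntegrable hX1 (B := fun _ => ContinuousLinearMap.id ℝ E3) continuous_const
  have ib : IntervalIntegrable (fun t => cross (gaussMap X (γ t)) (d X (γ t) (velocity γ t)))
      volume 0 1 := hγ.intervalIntegrable hX1 (continuous_crossCLM.comp hN)
  have il : IntervalIntegrable
      (fun t => deform r (gaussMap X (γ t)) (d X (γ t) (velocity γ t))) volume 0 1 :=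
    hγ.intervalIntegrable hX1 ((continuous_deform r).comp hN)
  have ha : ∀ k, ∫ t in (0 : ℝ)..1, d X (γ t) (velocity γ t) k = 0 := fun k => by
    rw [← intervalIntegral_apply ia, hγ.lineIntegral_id hX1, hc, sub_self]
    rfl
  apply ext_three
  · change _ = (r - r⁻¹) / 2 * flux X γ 1
    rw [flux, intervalIntegral_apply ib, lineIntegral, intervalIntegral_apply il,
      ← intervalIntegral.integral_const_mul]
    -- The first term is exact and has no period by `ha`; the second is a coordinate of the flux
    -- integrand.
    have : ∀ t, deform r (gaussMap X (γ t)) (d X (γ t) (velocity γ t)) 0 =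
        (r + r⁻¹) / 2 * d X (γ t) (velocity γ t) 0 +
        (r - r⁻¹) / 2 * cross (gaussMap X (γ t)) (d X (γ t) (velocity γ t)) 1 := fun t => by
      rw [deform_apply_zero, cross_apply_one, factor]; ring
    simp only [this]
    rw [intervalIntegral.integral_add ((intervalIntegrable_apply ia 0).const_mul _)
      ((intervalIntegrable_apply ib 1).const_mul _), intervalIntegral.integral_const_mul, ha, mul_zero,
      zero_add]
  · change _ = -((r - r⁻¹) / 2 * flux X γ 0)
    rw [flux, intervalIntegral_apply ib, lineIntegral, intervalIntegral_apply il,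
      ← neg_mul, ← intervalIntegral.integral_const_mul]
    have : ∀ t, deform r (gaussMap X (γ t)) (d X (γ t) (velocity γ t)) 1 =
        (r + r⁻¹) / 2 * d X (γ t) (velocity γ t) 1 +
        -((r - r⁻¹) / 2) * cross (gaussMap X (γ t)) (d X (γ t) (velocity γ t)) 0 := fun t => by
      rw [deform_apply_one, cross_apply_zero, factor]; ring
    simp only [this]
    rw [intervalIntegral.integral_add ((intervalIntegrable_apply ia 1).const_mul _)
      ((intervalIntegrable_apply ib 0).const_mul _), intervalIntegral.integral_const_mul, ha, mul_zero,
      zero_add]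
  · change _ = (0 : ℝ)
    rw [lineIntegral, intervalIntegral_apply il]
    simp only [deform_apply_two, ha]

theorem forall_isSingleValued_iff [ConnectedSpace M] (hX2 : ContMDiff 𝓘(ℝ, ℂ) 𝓘(ℝ, E3) 2 X)
    (hX : ∀ p, IsConformalMap (d X p)) :
    (∀ r : ℝ, 0 < r → IsSingleValued X r) ↔ HasVerticalFlux X := by
  constructor
  · intro h γ hγ hc
    -- Any positive r ≠ 1 would do: the coefficient (r - r⁻¹)/2 of the horizontal flux must not
    -- vanish.
    obtain ⟨Y, hY⟩ := h 2 two_pos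
    rw [isDeformation_iff hX] at hY
    have h1 := hY γ hγ
    rw [hc, sub_self, lineIntegral_deform_of_closed hX2 hX 2 hγ hc] at h1
    have e0 : (0 : ℝ) = ((2 : ℝ) - 2⁻¹) / 2 * flux X γ 1 := congrArg (fun v : E3 => v 0) h1
    have e1 : (0 : ℝ) = -(((2 : ℝ) - 2⁻¹) / 2 * flux X γ 0) := congrArg (fun v : E3 => v 1) h1
    constructor <;> linarith
  · intro h r _
    have hX1 : ContMDiff 𝓘(ℝ, ℂ) 𝓘(ℝ, E3) 1 X := hX2.of_le (by norm_num)
    have hB : Continuous fun p => deform r (gaussMap X p) :=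
      (continuous_deform r).comp (contMDiff_gaussMap hX2 hX).continuous
    obtain ⟨Y, hY⟩ := exists_primitive hX1 hB fun γ hγ hc => by
      rw [lineIntegral_deform_of_closed hX2 hX r hγ hc, (h γ hγ hc).1, (h γ hγ hc).2]
      apply ext_three <;> simp
    exact ⟨Y, (isDeformation_iff hX r).2 hY⟩

end Flux

end LopezRos
end

theorem proposition3p2 {M : Type*} [TopologicalSpace M] [T2Space M] [ConnectedSpace M]
    [ChartedSpace ℂ M] [IsManifold 𝓘(ℂ) ω M] [MeasurableSpace M] [BorelSpace M]
    (X : M → LopezRos.E3) (hX : LopezRos.IsConformalMinimalImmersion X) :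
    (∀ r : ℝ, 0 < r → (LopezRos.IsCompleteMap X ↔ LopezRos.IsCompleteDeformation X r)) ∧
    (∀ r : ℝ, 0 < r → ∀ Y : M → LopezRos.E3, LopezRos.IsDeformation X r Y →
      (LopezRos.HasFiniteTotalCurvature X ↔ LopezRos.HasFiniteTotalCurvature Y)) ∧
    ((∀ r : ℝ, 0 < r → LopezRos.IsSingleValued X r) ↔ LopezRos.HasVerticalFlux X) :=
  ⟨fun _ hr => LopezRos.isCompleteMap_iff hX.conformal hr,
    fun _ hr _ hY =>
      LopezRos.HasFiniteTotalCurvature.iff_deformation hX.contMDiff hX.conformal hr hY,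
    LopezRos.forall_isSingleValued_iff hX.contMDiff hX.conformal⟩
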